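/- Let $q>p\ge 1$ and $S>0$ be real numbers. There exist constants $C_1,C_2>0$, depending only on $p$, $q$ and $S$, such that the following holds. Let $M$ be a complete connected (smooth) Riemannian manifold of any dimension, let $K\subset M$ be compact, and let $E$ be an end of $M$ with respect to $K$, i.e. an unbounded connected component of $M\setminus K$. Assume that the $L^{q,p}$-Sobolev inequality with constant $S$ holds on $E$: $$S\,\|\varphi\|_{L^q}\le \|\nabla\varphi\|_{L^p}\qquad\text{for every }\varphi\in C_c^\infty(E).$$ Then: 1. for every geodesic ball $B_R(x_0)\subset E$, $R>0$, one has $\mathrm{vol}(B_R(x_0))\ge C_1R^{C_2}$; 2. if $o\in M$ and $R_0$ are such that $K\subset B_{R_0}(o)$, then for every $R$ and every $x_0\in E$ with $d(x_0,o)\ge R+R_0$ the ball $B_R(x_0)$ is contained in $E$; 3. $\mathrm{vol}(E)=+\infty$. -/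

import Mathlib

open MeasureTheory Set Bundle
open scoped Manifold ContDiff ENNReal

noncomputable section

/-- The Gram matrix `g_{ab}(y) = ⟨∂_a, ∂_b⟩` of the Riemannian metric in the preferred chart at `x`,
as a function of the coordinates `y` (meaningful for `y` in the target of the chart). -/
def chartGram {n : ℕ} {M : Type*} [TopologicalSpace M]
    [ChartedSpace (EuclideanSpace ℝ (Fin n)) M]
    [RiemannianBundle (fun x : M ↦ TangentSpace (𝓡 n) x)]
    (x : M) (y : EuclideanSpace ℝ (Fin n)) : Matrix (Fin n) (Fin n) ℝ :=
  Matrix.of fun a b ↦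
    inner ℝ
      (mfderiv (𝓡 n) (𝓡 n) (chartAt (EuclideanSpace ℝ (Fin n)) x).symm y
        (EuclideanSpace.single a (1 : ℝ)))
      (mfderiv (𝓡 n) (𝓡 n) (chartAt (EuclideanSpace ℝ (Fin n)) x).symm y
        (EuclideanSpace.single b (1 : ℝ)))

/-- The measure `√(det g) dy` of the preferred chart at `x`, transported to `M`; it is carried by
the chart domain. -/
def chartVolume (n : ℕ) {M : Type*} [TopologicalSpace M] [MeasurableSpace M]
    [ChartedSpace (EuclideanSpace ℝ (Fin n)) M]
    [RiemannianBundle (fun x : M ↦ TangentSpace (𝓡 n) x)] (x : M) : Measure M :=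
  ((volume.restrict (chartAt (EuclideanSpace ℝ (Fin n)) x).target).withDensity
    (fun y ↦ ENNReal.ofReal (√(chartGram x y).det))).map
      (chartAt (EuclideanSpace ℝ (Fin n)) x).symm

/-- The push-forward in `chartVolume` is along an almost everywhere measurable map, so that the
chart measure is given by the expected formula
`∫_{φ(s ∩ dom φ)} √(det g) dy` (and not by a default value). -/
theorem chartVolume_apply (n : ℕ) {M : Type*} [TopologicalSpace M] [MeasurableSpace M]
    [BorelSpace M] [ChartedSpace (EuclideanSpace ℝ (Fin n)) M]
    [RiemannianBundle (fun x : M ↦ TangentSpace (𝓡 n) x)] (x : M) {s : Set M}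
    (hs : MeasurableSet s) :
    chartVolume n x s =
      ∫⁻ y in (chartAt (EuclideanSpace ℝ (Fin n)) x).target ∩
          (chartAt (EuclideanSpace ℝ (Fin n)) x).symm ⁻¹' s,
        ENNReal.ofReal (√(chartGram x y).det) := by
  have ht : MeasurableSet (chartAt (EuclideanSpace ℝ (Fin n)) x).target :=
    (chartAt (EuclideanSpace ℝ (Fin n)) x).open_target.measurableSet
  have hm : AEMeasurable (chartAt (EuclideanSpace ℝ (Fin n)) x).symm
      (volume.restrict (chartAt (EuclideanSpace ℝ (Fin n)) x).target) :=
    (chartAt (EuclideanSpace ℝ (Fin n)) x).continuousOn_symm.aemeasurable ht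
  rw [chartVolume, Measure.map_apply_of_aemeasurable
    (hm.mono_ac (withDensity_absolutelyContinuous _ _)) hs, withDensity_apply',
    Measure.restrict_restrict' ht, inter_comm]

/-- The Riemannian volume measure. By the change of variables formula the measures `√(det g) dy`
of two charts agree on the overlap of the chart domains; the volume is the measure that restricts
to `√(det g) dy` on every chart domain, and it is their least upper bound among measures
(`M` being covered by countably many chart domains). -/
def riemannianVolume (n : ℕ) (M : Type*) [TopologicalSpace M] [MeasurableSpace M]
    [ChartedSpace (EuclideanSpace ℝ (Fin n)) M]
    [RiemannianBundle (fun x : M ↦ TangentSpace (𝓡 n) x)] : Measure M :=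
  ⨆ x : M, chartVolume n x

/-- The Gram matrix of a composition `L ∘ D` is `Bᵀ G B`, with `G` that of `L` and `B` the matrix
of `D`. -/
theorem gram_comp {n : ℕ} {T : Type*} [NormedAddCommGroup T] [InnerProductSpace ℝ T]
    (L : EuclideanSpace ℝ (Fin n) →L[ℝ] T)
    (D : EuclideanSpace ℝ (Fin n) →L[ℝ] EuclideanSpace ℝ (Fin n)) (a b : Fin n) :
    (inner ℝ (L (D (EuclideanSpace.single a (1 : ℝ)))) (L (D (EuclideanSpace.single b (1 : ℝ)))) : ℝ) =
      ((LinearMap.toMatrix (EuclideanSpace.basisFun (Fin n) ℝ).toBasis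
          (EuclideanSpace.basisFun (Fin n) ℝ).toBasis (D : EuclideanSpace ℝ (Fin n) →ₗ[ℝ] EuclideanSpace ℝ (Fin n))).transpose *
        (Matrix.of fun c d ↦ (inner ℝ (L (EuclideanSpace.single c (1 : ℝ))) (L (EuclideanSpace.single d (1 : ℝ))) : ℝ)) *
        LinearMap.toMatrix (EuclideanSpace.basisFun (Fin n) ℝ).toBasis
          (EuclideanSpace.basisFun (Fin n) ℝ).toBasis (D : EuclideanSpace ℝ (Fin n) →ₗ[ℝ] EuclideanSpace ℝ (Fin n))) a b := by
  set B := LinearMap.toMatrix (EuclideanSpace.basisFun (Fin n) ℝ).toBasis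
          (EuclideanSpace.basisFun (Fin n) ℝ).toBasis (D : EuclideanSpace ℝ (Fin n) →ₗ[ℝ] EuclideanSpace ℝ (Fin n)) with hB
  have hcol : ∀ a, D (EuclideanSpace.single a (1:ℝ)) = ∑ c, B c a • EuclideanSpace.single c (1:ℝ) := by
    intro a
    ext i
    simp [B, LinearMap.toMatrix_apply, Pi.single_apply]
  rw [hcol, hcol, map_sum, map_sum]
  simp only [map_smul, sum_inner, inner_sum, inner_smul_left, inner_smul_right, Matrix.mul_apply, Matrix.transpose_apply, Matrix.of_apply, Finset.sum_mul, Finset.mul_sum]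
  refine Finset.sum_congr rfl fun c _ => Finset.sum_congr rfl fun d _ => ?_
  simp
  ring

/-- Independence of the chart: two chart measures agree on the overlap of the chart domains. -/
theorem chartVolume_eq_of_subset (n : ℕ) {M : Type*} [TopologicalSpace M] [MeasurableSpace M]
    [BorelSpace M] [ChartedSpace (EuclideanSpace ℝ (Fin n)) M] [IsManifold (𝓡 n) ∞ M]
    [RiemannianBundle (fun x : M ↦ TangentSpace (𝓡 n) x)] (x x' : M) {s : Set M}
    (hs : MeasurableSet s) (h : s ⊆ (chartAt (EuclideanSpace ℝ (Fin n)) x).source)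
    (h' : s ⊆ (chartAt (EuclideanSpace ℝ (Fin n)) x').source) :
    chartVolume n x s = chartVolume n x' s := by
  set H := EuclideanSpace ℝ (Fin n)
  set e := chartAt H x
  set e' := chartAt H x'
  set A := e.target ∩ e.symm ⁻¹' s with hA
  set A' := e'.target ∩ e'.symm ⁻¹' s with hA'
  set τ : H → H := fun y => e' (e.symm y)
  have hmem : ∀ y ∈ A, y ∈ (e.symm.trans e').source := fun y hy => by
    simp only [OpenPartialHomeomorph.trans_source, OpenPartialHomeomorph.symm_source]
    exact ⟨hy.1, h' hy.2⟩
  have him : τ '' A = A' := by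
    ext z
    constructor
    · rintro ⟨y, hy, rfl⟩
      refine ⟨e'.map_source (h' hy.2), ?_⟩
      simp only [τ, mem_preimage, e'.left_inv (h' hy.2)]
      exact hy.2
    · rintro hz
      refine ⟨e (e'.symm z), ⟨e.map_source (h hz.2), ?_⟩, ?_⟩
      · simp only [mem_preimage, e.left_inv (h hz.2)]; exact hz.2
      · simp only [τ, e.left_inv (h hz.2), e'.right_inv hz.1]
  have hAm : MeasurableSet A := by
    classical
    have := e.continuousOn_symm.measurable_piecewise (g := fun _ => x) continuousOn_const
       e.open_target.measurableSet
    have h2 := e.open_target.measurableSet.inter (this hs)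
    convert h2 using 1
    ext y
    simp only [hA, mem_inter_iff, mem_preimage]
    refine and_congr_right fun hy => ?_
    rw [Set.piecewise_eq_of_mem _ _ _ hy]
  have hinj : InjOn τ A := fun y hy z hz hyz => by
    have := e'.injOn (h' hy.2) (h' hz.2) hyz
    exact e.symm.injOn hy.1 hz.1 this
  have d1 : ∀ z ∈ A', MDifferentiableAt (𝓡 n) (𝓡 n) e'.symm z := fun z hz =>
    mdifferentiableAt_atlas_symm (chart_mem_atlas H x') hz.1
  have d0 : ∀ z ∈ A, MDifferentiableAt (𝓡 n) (𝓡 n) e.symm z := fun z hz =>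
    mdifferentiableAt_atlas_symm (chart_mem_atlas H x) hz.1
  have d2 : ∀ y ∈ A, MDifferentiableAt (𝓡 n) (𝓡 n) τ y := fun y hy =>
    (mdifferentiableAt_atlas (I := 𝓡 n) (chart_mem_atlas H x') (h' hy.2)).comp y (d0 y hy)
  have hd : ∀ y ∈ A, HasFDerivWithinAt τ (fderiv ℝ τ y) A y := fun y hy =>
    (mdifferentiableAt_iff_differentiableAt.1 (d2 y hy)).hasFDerivAt.hasFDerivWithinAt
  have key : ∀ y ∈ A, (chartGram x y).det = (fderiv ℝ τ y).det ^ 2 * (chartGram x' (τ y)).det := by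
    intro y hy
    have hy' : τ y ∈ A' := him ▸ mem_image_of_mem τ hy
    have hev : e.symm =ᶠ[nhds y] e'.symm ∘ τ := by
      have : (e.symm.trans e').source ∈ nhds y := (e.symm.trans e').open_source.mem_nhds (hmem y hy)
      filter_upwards [this] with z hz
      rw [OpenPartialHomeomorph.trans_source] at hz
      simp [τ, e'.left_inv hz.2]
    have hc : ∀ v : H, (mfderiv (𝓡 n) (𝓡 n) e.symm y v : H) = (mfderiv (𝓡 n) (𝓡 n) e'.symm (τ y) (fderiv ℝ τ y v) : H) := by
      intro v
      rw [hev.mfderiv_eq, mfderiv_comp y (d1 _ hy') (d2 y hy), ← mfderiv_eq_fderiv]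
      rfl
    have hpt : e.symm y = e'.symm (τ y) := hev.self_of_nhds
    let B : Matrix (Fin n) (Fin n) ℝ := LinearMap.toMatrix (EuclideanSpace.basisFun (Fin n) ℝ).toBasis (EuclideanSpace.basisFun (Fin n) ℝ).toBasis (fderiv ℝ τ y : H →ₗ[ℝ] H)
    have hB : (fderiv ℝ τ y).det = B.det := by
      rw [LinearMap.det_toMatrix]
    have hGram : chartGram x y = B.transpose * chartGram x' (τ y) * B := by
      have hin : ∀ (m m' : M) (hm : m = m') (v w : H), (inner ℝ (show TangentSpace (𝓡 n) m from v) (show TangentSpace (𝓡 n) m from w) : ℝ) = inner ℝ (show TangentSpace (𝓡 n) m' from v) (show TangentSpace (𝓡 n) m' from w) := by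
        rintro m _ rfl v w; rfl
      ext a b
      have : chartGram x y a b = inner ℝ (mfderiv (𝓡 n) (𝓡 n) e'.symm (τ y) (fderiv ℝ τ y (EuclideanSpace.single a (1:ℝ)))) (mfderiv (𝓡 n) (𝓡 n) e'.symm (τ y) (fderiv ℝ τ y (EuclideanSpace.single b (1:ℝ)))) := by
        refine (hin _ _ hpt _ _).trans ?_
        erw [hc, hc]
      rw [this]
      exact gram_comp (mfderiv (𝓡 n) (𝓡 n) e'.symm (τ y)) (fderiv ℝ τ y) a b
    rw [hGram, Matrix.det_mul, Matrix.det_mul, Matrix.det_transpose, hB]; ring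
  rw [chartVolume_apply n x hs, chartVolume_apply n x' hs]
  change ∫⁻ y in A, _ = ∫⁻ y in A', _
  rw [← him, lintegral_image_eq_lintegral_abs_det_fderiv_mul volume hAm hd hinj]
  refine setLIntegral_congr_fun hAm fun y hy => ?_
  rw [key y hy, Real.sqrt_mul (sq_nonneg _), Real.sqrt_sq_eq_abs, ENNReal.ofReal_mul (abs_nonneg _)]

/-- The volume restricts to `√(det g) dy` on every chart domain. -/
theorem riemannianVolume_eq_chartVolume (n : ℕ) {M : Type*} [TopologicalSpace M]
    [MeasurableSpace M] [BorelSpace M] [ChartedSpace (EuclideanSpace ℝ (Fin n)) M]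
    [IsManifold (𝓡 n) ∞ M] [RiemannianBundle (fun x : M ↦ TangentSpace (𝓡 n) x)] (x : M)
    {s : Set M} (hs : MeasurableSet s)
    (h : s ⊆ (chartAt (EuclideanSpace ℝ (Fin n)) x).source) :
    riemannianVolume n M s = chartVolume n x s := by
  set U := (chartAt (EuclideanSpace ℝ (Fin n)) x).source
  have hU : MeasurableSet U := (chartAt (EuclideanSpace ℝ (Fin n)) x).open_source.measurableSet
  refine le_antisymm ?_ (le_iSup (fun x : M ↦ chartVolume n x) x s)
  let ρ : Measure M := chartVolume n x + ((⊤ : ℝ≥0∞) • Measure.count).restrict Uᶜ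
  have hρ : riemannianVolume n M ≤ ρ := by
    refine iSup_le fun x' => Measure.le_iff.2 fun t ht => ?_
    set U' := (chartAt (EuclideanSpace ℝ (Fin n)) x').source
    have hU' : MeasurableSet U' := (chartAt (EuclideanSpace ℝ (Fin n)) x').open_source.measurableSet
    rcases (t ∩ Uᶜ).eq_empty_or_nonempty with he | hne
    · have htU : t ⊆ U := by
        rw [← Set.sdiff_eq, Set.sdiff_eq_empty] at he
        exact he
      have h1 : chartVolume n x' t = chartVolume n x' (t ∩ U') := by
        rw [chartVolume_apply n x' ht, chartVolume_apply n x' (ht.inter hU')]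
        congr 2
        ext y
        simp only [mem_inter_iff, mem_preimage]
        exact ⟨fun hy => ⟨hy.1, hy.2, (chartAt (EuclideanSpace ℝ (Fin n)) x').map_target hy.1⟩,
          fun hy => ⟨hy.1, hy.2.1⟩⟩
      rw [h1, chartVolume_eq_of_subset n x' x (ht.inter hU') inter_subset_right (inter_subset_left.trans htU)]
      exact (measure_mono inter_subset_left).trans (Measure.le_add_right le_rfl t)
    · have : ρ t = ⊤ := by
        simp only [ρ, Measure.add_apply, Measure.restrict_apply ht, Measure.smul_apply, smul_eq_mul]
        rw [ENNReal.top_mul, add_top]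
        exact (Measure.count_ne_zero hne)
      rw [this]; exact le_top
  refine (hρ s).trans ?_
  simp only [ρ, Measure.add_apply, Measure.restrict_apply hs]
  rw [← Set.sdiff_eq, Set.sdiff_eq_empty.2 h]
  simp

/-- The Riemannian gradient: `⟨∇φ(x), v⟩ = dφ_x(v)` for every tangent vector `v` at `x`. -/
def riemannianGradient (n : ℕ) {M : Type*} [TopologicalSpace M]
    [ChartedSpace (EuclideanSpace ℝ (Fin n)) M]
    [RiemannianBundle (fun x : M ↦ TangentSpace (𝓡 n) x)] (φ : M → ℝ) (x : M) :
    TangentSpace (𝓡 n) x :=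
  haveI : FiniteDimensional ℝ (TangentSpace (𝓡 n) x) :=
    inferInstanceAs (FiniteDimensional ℝ (EuclideanSpace ℝ (Fin n)))
  haveI : CompleteSpace (TangentSpace (𝓡 n) x) := FiniteDimensional.complete ℝ _
  (InnerProductSpace.toDual ℝ (TangentSpace (𝓡 n) x)).symm (mfderiv (𝓡 n) 𝓘(ℝ, ℝ) φ x)

/-- The `L^{q,p}`-Sobolev inequality with constant `S` on the set `E` (meant for `E` open):
`S ‖φ‖_{L^q} ≤ ‖∇φ‖_{L^p}` for all `φ ∈ C_c^∞(E)`. -/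
def SobolevInequalityOn (n : ℕ) {M : Type*} [TopologicalSpace M] [MeasurableSpace M]
    [ChartedSpace (EuclideanSpace ℝ (Fin n)) M]
    [RiemannianBundle (fun x : M ↦ TangentSpace (𝓡 n) x)]
    (q p S : ℝ) (E : Set M) : Prop :=
  ∀ φ : M → ℝ, ContMDiff (𝓡 n) 𝓘(ℝ, ℝ) ∞ φ → HasCompactSupport φ → tsupport φ ⊆ E →
    ENNReal.ofReal S * eLpNorm φ (ENNReal.ofReal q) (riemannianVolume n M) ≤
      eLpNorm (fun x ↦ ‖riemannianGradient n φ x‖) (ENNReal.ofReal p) (riemannianVolume n M)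

/-- `E` is an end with respect to `K`: an unbounded connected component of `M \ K`. -/
def IsEndOf {M : Type*} [MetricSpace M] (K E : Set M) : Prop :=
  (∃ x ∈ Kᶜ, E = connectedComponentIn Kᶜ x) ∧ ¬ Bornology.IsBounded E

end

/-! Write `V(r)` for the volume of the ball of radius `r` about `x₀`. Testing the Sobolev inequality
on a cutoff equal to `1` on the ball of radius `r / 2`, supported in the ball of radius `r`, with
gradient at most `40 * C / r`, gives `V(r) ≥ (S r / (40 C))^p V(r/2)^(p/q)`
(`SobolevInequalityOn.volume_ball_half_le`). Put `θ = p / q < 1` and iterate over the radii `R /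
2^k`. The powers of `R` add up to `p (1 + θ + θ² + ...) = p / (1 - θ)`, which is `C₂`, and the
remaining factor is `V(R/2^k)^(θ^k)`. Small balls have volume at least `c r^n`
(`exists_mul_pow_le_riemannianVolume_ball`), so the lower limit of this factor is at least `1`.
Hence `c` and `n`, which depend on `M` and `x₀`, leave no trace in `C₁` and `C₂`. In logarithmic
form this is `le_of_affine_recursion`. The cutoff must be smooth, while the distance function is
only Lipschitz. It is mollified in charts and glued by a partition of unity with control of the
gradient (`exists_contMDiff_approx_on_compact`), then composed with a smooth step. Compactness of
its support is Hopf–Rinow (`isCompact_closedBall_of_isRiemannianManifold`). For the second claim,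
balls are connected because distance is an infimum of path lengths, so a ball centred in `E` that
misses `K` stays in the component `E`. Since `E` is unbounded it therefore contains balls of every
radius, and the volume bound makes its volume infinite. -/

/-! ### Continuity of the metric in the preferred chart -/

section ChartMetric

open Filter Topology

variable {n : ℕ} {M : Type*} [MetricSpace M]
  [ChartedSpace (EuclideanSpace ℝ (Fin n)) M] [IsManifold (𝓡 n) ∞ M]
  [RiemannianBundle (fun x : M ↦ TangentSpace (𝓡 n) x)]
  [IsContMDiffRiemannianBundle (𝓡 n) ∞ (EuclideanSpace ℝ (Fin n))
    (fun x : M ↦ TangentSpace (𝓡 n) x)]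

theorem isContinuousRiemannianBundle_tangentSpace :
    IsContinuousRiemannianBundle (EuclideanSpace ℝ (Fin n))
      (fun x : M ↦ TangentSpace (𝓡 n) x) := by
  obtain ⟨g, hg, h⟩ := IsContMDiffRiemannianBundle.exists_contMDiff (IB := 𝓡 n) (n := ∞)
    (F := EuclideanSpace ℝ (Fin n)) (E := fun x : M ↦ TangentSpace (𝓡 n) x)
  exact ⟨g, hg.continuous, h⟩

/-- The differential of the inverse of a chart distorts the norm, relative to the centre of the
chart, by a factor arbitrarily close to `1`. -/
theorem eventually_norm_mfderiv_chartAt_symm (x₀ : M) {r : ℝ} (hr : 1 < r) :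
    ∀ᶠ x in 𝓝 x₀, ∀ v : EuclideanSpace ℝ (Fin n),
      ‖mfderiv (𝓡 n) (𝓡 n) (chartAt (EuclideanSpace ℝ (Fin n)) x₀).symm
          (chartAt (EuclideanSpace ℝ (Fin n)) x₀ x) v‖ ≤
        r * ‖mfderiv (𝓡 n) (𝓡 n) (chartAt (EuclideanSpace ℝ (Fin n)) x₀).symm
          (chartAt (EuclideanSpace ℝ (Fin n)) x₀ x₀) v‖ ∧
      ‖mfderiv (𝓡 n) (𝓡 n) (chartAt (EuclideanSpace ℝ (Fin n)) x₀).symm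
          (chartAt (EuclideanSpace ℝ (Fin n)) x₀ x₀) v‖ ≤
        r * ‖mfderiv (𝓡 n) (𝓡 n) (chartAt (EuclideanSpace ℝ (Fin n)) x₀).symm
          (chartAt (EuclideanSpace ℝ (Fin n)) x₀ x) v‖ := by
  have : IsContinuousRiemannianBundle (EuclideanSpace ℝ (Fin n))
      (fun x : M ↦ TangentSpace (𝓡 n) x) := isContinuousRiemannianBundle_tangentSpace
  have : IsManifold (𝓡 n) 1 M := IsManifold.of_le (n := ∞) (by simp)
  set H := EuclideanSpace ℝ (Fin n)
  set t := trivializationAt H (fun x : M ↦ TangentSpace (𝓡 n) x) x₀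
  -- The tangent bundle trivialization is inverted by the differential of the inverse chart. The two
  -- vectors lie over `x` and over `e.symm (e x)` for the chart `e`, so the norm has to be
  -- transported along the equality of these points.
  have key : ∀ x ∈ (chartAt H x₀).source, ∀ v : H,
      ‖t.symmL ℝ x v‖ = ‖mfderiv (𝓡 n) (𝓡 n) (chartAt H x₀).symm (chartAt H x₀ x) v‖ := by
    intro x hx v
    have h := TangentBundle.symmL_trivializationAt (𝕜 := ℝ) (I := 𝓡 n) hx
    have h2 : (t.symmL ℝ x v : H) =
        (mfderiv (𝓡 n) (𝓡 n) (chartAt H x₀).symm (chartAt H x₀ x) v : H) := by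
      rw [h, ModelWithCorners.range_eq_univ, mfderivWithin_univ]
      rfl
    have h3 : ∀ (m m' : M), m = m' → ∀ w : H,
        ‖(show TangentSpace (𝓡 n) m from w)‖ = ‖(show TangentSpace (𝓡 n) m' from w)‖ := by
      rintro m _ rfl w; rfl
    exact (congrArg (fun w : H ↦ ‖(show TangentSpace (𝓡 n) x from w)‖) h2).trans
      (h3 _ _ ((chartAt H x₀).left_inv hx).symm _)
  have h1 := eventually_norm_symmL_trivializationAt_comp_self_lt H
    (fun x : M ↦ TangentSpace (𝓡 n) x) x₀ hr
  have h2 := eventually_norm_symmL_trivializationAt_self_comp_lt H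
    (fun x : M ↦ TangentSpace (𝓡 n) x) x₀ hr
  filter_upwards [h1, h2, (chartAt H x₀).open_source.mem_nhds (mem_chart_source H x₀)]
    with x hx1 hx2 hxs v
  rw [← key x hxs, ← key x₀ (mem_chart_source H x₀)]
  have hb : x ∈ t.baseSet := by simpa [t] using hxs
  have hb0 : x₀ ∈ t.baseSet := FiberBundle.mem_baseSet_trivializationAt' x₀
  constructor
  -- The change of fibre from `x₀` to `x` sends `t.symmL ℝ x₀ v` to `t.symmL ℝ x v` and has norm
  -- less than `r`.
  · have := (t.symmL ℝ x ∘L t.continuousLinearMapAt ℝ x₀).le_of_opNorm_le hx1.le (t.symmL ℝ x₀ v)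
    simpa [t.continuousLinearMapAt_symmL hb0] using this
  · have := (t.symmL ℝ x₀ ∘L t.continuousLinearMapAt ℝ x).le_of_opNorm_le hx2.le (t.symmL ℝ x v)
    simpa [t.continuousLinearMapAt_symmL hb] using this

end ChartMetric

/-! ### Comparison of the distance with the norm frozen at the centre of a chart -/

section ChartNorm

open Filter Topology Manifold

variable {n : ℕ} {M : Type*} [MetricSpace M]
  [ChartedSpace (EuclideanSpace ℝ (Fin n)) M]
  [RiemannianBundle (fun x : M ↦ TangentSpace (𝓡 n) x)]

/-- The norm of the coordinate vector `v`, seen as a tangent vector at the centre `x₀` of the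
preferred chart at `x₀`. -/
noncomputable def chartNorm (x₀ : M) (v : EuclideanSpace ℝ (Fin n)) : ℝ :=
  ‖mfderiv (𝓡 n) (𝓡 n) (chartAt (EuclideanSpace ℝ (Fin n)) x₀).symm
    (chartAt (EuclideanSpace ℝ (Fin n)) x₀ x₀) v‖

theorem chartNorm_nonneg (x₀ : M) (v : EuclideanSpace ℝ (Fin n)) : 0 ≤ chartNorm x₀ v :=
  norm_nonneg _

theorem chartNorm_smul (x₀ : M) (c : ℝ) (v : EuclideanSpace ℝ (Fin n)) :
    chartNorm x₀ (c • v) = |c| * chartNorm x₀ v := by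
  unfold chartNorm
  erw [map_smul, norm_smul]
  rfl

theorem exists_chartNorm_le (x₀ : M) :
    ∃ A > 0, ∀ v : EuclideanSpace ℝ (Fin n), chartNorm x₀ v ≤ A * ‖v‖ := by
  let L : EuclideanSpace ℝ (Fin n) →L[ℝ] TangentSpace (𝓡 n)
      ((chartAt (EuclideanSpace ℝ (Fin n)) x₀).symm (chartAt (EuclideanSpace ℝ (Fin n)) x₀ x₀)) :=
    mfderiv (𝓡 n) (𝓡 n) (chartAt (EuclideanSpace ℝ (Fin n)) x₀).symm
      (chartAt (EuclideanSpace ℝ (Fin n)) x₀ x₀)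
  refine ⟨‖L‖ + 1, by positivity, fun v ↦ ?_⟩
  calc chartNorm x₀ v = ‖L v‖ := rfl
    _ ≤ ‖L‖ * ‖v‖ := L.le_opNorm v
    _ ≤ (‖L‖ + 1) * ‖v‖ := by gcongr; linarith

variable [IsManifold (𝓡 n) ∞ M]

theorem norm_mfderiv_chartAt_symm_comp (x₀ : M) {η : ℝ → EuclideanSpace ℝ (Fin n)}
    {w : EuclideanSpace ℝ (Fin n)} {t : ℝ} (hη : HasDerivAt η w t)
    (ht : η t ∈ (chartAt (EuclideanSpace ℝ (Fin n)) x₀).target) :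
    ‖mfderiv 𝓘(ℝ, ℝ) (𝓡 n) ((chartAt (EuclideanSpace ℝ (Fin n)) x₀).symm ∘ η) t (1 : ℝ)‖ =
      ‖mfderiv (𝓡 n) (𝓡 n) (chartAt (EuclideanSpace ℝ (Fin n)) x₀).symm (η t) w‖ := by
  have d1 : MDifferentiableAt (𝓡 n) (𝓡 n) (chartAt (EuclideanSpace ℝ (Fin n)) x₀).symm (η t) :=
    mdifferentiableAt_atlas_symm (chart_mem_atlas _ x₀) ht
  have d2 : MDifferentiableAt 𝓘(ℝ, ℝ) (𝓡 n) η t := hη.differentiableAt.mdifferentiableAt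
  have h1 : (mfderiv 𝓘(ℝ, ℝ) (𝓡 n) η t (1 : ℝ) : EuclideanSpace ℝ (Fin n)) = w := by
    rw [mfderiv_eq_fderiv]
    exact hη.deriv
  rw [mfderiv_comp t d1 d2]
  exact congrArg (fun v : EuclideanSpace ℝ (Fin n) ↦
    ‖mfderiv (𝓡 n) (𝓡 n) (chartAt (EuclideanSpace ℝ (Fin n)) x₀).symm (η t) v‖) h1

/-- The coordinate segment from `y` to `z` stays in the convex ball, and the length of its image
bounds the distance. -/
theorem dist_chartAt_symm_le [IsRiemannianManifold (𝓡 n) M] {x₀ : M} {ρ : ℝ}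
    (ht : Metric.ball (chartAt (EuclideanSpace ℝ (Fin n)) x₀ x₀) ρ ⊆
      (chartAt (EuclideanSpace ℝ (Fin n)) x₀).target)
    (hb : ∀ y ∈ Metric.ball (chartAt (EuclideanSpace ℝ (Fin n)) x₀ x₀) ρ,
      ∀ v : EuclideanSpace ℝ (Fin n),
        ‖mfderiv (𝓡 n) (𝓡 n) (chartAt (EuclideanSpace ℝ (Fin n)) x₀).symm y v‖ ≤
          2 * chartNorm x₀ v)
    {y z : EuclideanSpace ℝ (Fin n)}
    (hy : y ∈ Metric.ball (chartAt (EuclideanSpace ℝ (Fin n)) x₀ x₀) ρ)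
    (hz : z ∈ Metric.ball (chartAt (EuclideanSpace ℝ (Fin n)) x₀ x₀) ρ) :
    dist ((chartAt (EuclideanSpace ℝ (Fin n)) x₀).symm y)
      ((chartAt (EuclideanSpace ℝ (Fin n)) x₀).symm z) ≤ 2 * chartNorm x₀ (z - y) := by
  have : IsManifold (𝓡 n) 1 M := IsManifold.of_le (n := ∞) (by simp)
  let η : ℝ → EuclideanSpace ℝ (Fin n) := fun t ↦ y + t • (z - y)
  have hη : ∀ t ∈ Icc (0 : ℝ) 1, η t ∈ Metric.ball (chartAt (EuclideanSpace ℝ (Fin n)) x₀ x₀) ρ := fun t ht' ↦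
    (convex_ball (chartAt (EuclideanSpace ℝ (Fin n)) x₀ x₀) ρ).add_smul_sub_mem hy hz ht'
  have hηd : ∀ t, HasDerivAt η (z - y) t := fun t ↦ by
    simpa [η] using ((hasDerivAt_id t).smul_const (z - y)).const_add y
  have hηc : ContDiff ℝ 1 η := by fun_prop
  have hle : edist ((chartAt (EuclideanSpace ℝ (Fin n)) x₀).symm y) ((chartAt (EuclideanSpace ℝ (Fin n)) x₀).symm z) ≤ ENNReal.ofReal (2 * chartNorm x₀ (z - y)) := by
    rw [IsRiemannianManifold.out (I := 𝓡 n) ((chartAt (EuclideanSpace ℝ (Fin n)) x₀).symm y) ((chartAt (EuclideanSpace ℝ (Fin n)) x₀).symm z)]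
    have h1 : riemannianEDist (𝓡 n) ((chartAt (EuclideanSpace ℝ (Fin n)) x₀).symm y) ((chartAt (EuclideanSpace ℝ (Fin n)) x₀).symm z) ≤
        pathELength (𝓡 n) ((chartAt (EuclideanSpace ℝ (Fin n)) x₀).symm ∘ η) 0 1 := by
      refine riemannianEDist_le_pathELength ?_ (by simp [η]) (by simp [η]) zero_le_one
      exact (contMDiffOn_chart_symm (n := 1)).comp hηc.contMDiff.contMDiffOn
        fun t ht' ↦ ht (hη t ht')
    refine h1.trans ?_
    rw [pathELength_eq_lintegral_mfderiv_Icc]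
    calc _ ≤ ∫⁻ t in Icc (0 : ℝ) 1, ENNReal.ofReal (2 * chartNorm x₀ (z - y)) := by
          refine setLIntegral_mono' measurableSet_Icc fun t ht' ↦ ?_
          rw [← ofReal_norm]
          exact ENNReal.ofReal_le_ofReal ((norm_mfderiv_chartAt_symm_comp x₀ (hηd t)
            (ht (hη t ht'))).trans_le (hb _ (hη t ht') _))
      _ = _ := by simp
  rw [edist_dist] at hle
  exact (ENNReal.ofReal_le_ofReal_iff (by have := chartNorm_nonneg x₀ (z - y); positivity)).1 hle

variable [IsContMDiffRiemannianBundle (𝓡 n) ∞ (EuclideanSpace ℝ (Fin n))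
    (fun x : M ↦ TangentSpace (𝓡 n) x)]

/-- On a small ball of the chart at `x₀`, the metric is comparable to its value at `x₀`. -/
theorem exists_ball_norm_mfderiv_chartAt_symm (x₀ : M) : ∃ ρ > 0,
    Metric.ball (chartAt (EuclideanSpace ℝ (Fin n)) x₀ x₀) ρ ⊆
      (chartAt (EuclideanSpace ℝ (Fin n)) x₀).target ∧
    ∀ y ∈ Metric.ball (chartAt (EuclideanSpace ℝ (Fin n)) x₀ x₀) ρ,
      ∀ v : EuclideanSpace ℝ (Fin n),
        ‖mfderiv (𝓡 n) (𝓡 n) (chartAt (EuclideanSpace ℝ (Fin n)) x₀).symm y v‖ ≤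
          2 * chartNorm x₀ v ∧
        chartNorm x₀ v ≤
          2 * ‖mfderiv (𝓡 n) (𝓡 n) (chartAt (EuclideanSpace ℝ (Fin n)) x₀).symm y v‖ := by
  set H := EuclideanSpace ℝ (Fin n)
  set e := chartAt H x₀
  have h1 := eventually_norm_mfderiv_chartAt_symm (n := n) x₀ one_lt_two
  have hy0 : e x₀ ∈ e.target := mem_chart_target H x₀
  have hc : ContinuousAt e.symm (e x₀) := e.continuousAt_symm hy0
  have h2 : ∀ᶠ y in 𝓝 (e x₀), _ := hc.eventually
    (by rw [e.left_inv (mem_chart_source H x₀)]; exact h1)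
  obtain ⟨ρ, hρ, h⟩ := Metric.eventually_nhds_iff_ball.1
    ((e.open_target.eventually_mem hy0).and h2)
  refine ⟨ρ, hρ, fun y hy ↦ (h y hy).1, fun y hy v ↦ ?_⟩
  have := (h y hy).2 v
  rw [e.right_inv (h y hy).1] at this
  exact this

end ChartNorm

/-! ### Mollification in a vector space -/

section Mollification

open Filter Topology

variable {E : Type*} [NormedAddCommGroup E] [NormedSpace ℝ E] [FiniteDimensional ℝ E]

/-- Smoothing a continuous function preserves its Lipschitz constant with respect to any
homogeneous gauge `N`. -/
theorem exists_contDiff_dist_le_abs_fderiv_le {G : E → ℝ} (hG : Continuous G) {N : E → ℝ}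
    (hN0 : ∀ v, 0 ≤ N v) (hN : ∀ (c : ℝ) v, N (c • v) = |c| * N v) {c : E} {ρ : ℝ}
    (hlip : ∀ y ∈ Metric.ball c ρ, ∀ z ∈ Metric.ball c ρ, |G z - G y| ≤ N (z - y))
    {ε : ℝ} (hε : 0 < ε) (hρ : 0 < ρ) :
    ∃ g : E → ℝ, ContDiff ℝ ∞ g ∧
      ∀ y ∈ Metric.ball c (ρ / 2), |g y - G y| ≤ ε ∧ ∀ v, |fderiv ℝ g y v| ≤ N v := by
  borelize E
  let μ : Measure E := Measure.addHaar
  have huc := (isCompact_closedBall c ρ).uniformContinuousOn_of_continuous hG.continuousOn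
  obtain ⟨δ, hδ, hunif⟩ := Metric.uniformContinuousOn_iff_le.1 huc ε hε
  have hr : 0 < min δ (ρ / 2) := by positivity
  -- Radius at most `ρ / 2` keeps translates of the half ball inside the ball where `hlip` holds;
  -- radius at most `δ` gives the `ε`-closeness.
  let φ : ContDiffBump (0 : E) := ⟨min δ (ρ / 2) / 2, min δ (ρ / 2), by positivity, by linarith⟩
  let g : E → ℝ := convolution (φ.normed μ) G (ContinuousLinearMap.lsmul ℝ ℝ) μ
  have hg : ContDiff ℝ ∞ g :=
    φ.hasCompactSupport_normed.contDiff_convolution_left _ φ.contDiff_normed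
      hG.locallyIntegrable
  have hin : ∀ y, Integrable (fun t ↦ φ.normed μ t * G (y - t)) μ := fun y ↦
    (φ.contDiff_normed (n := 0)).continuous.mul (hG.comp (by fun_prop)) |>.integrable_of_hasCompactSupport
      φ.hasCompactSupport_normed.mul_right
  have hgl : ∀ y ∈ Metric.ball c (ρ / 2), ∀ z ∈ Metric.ball c (ρ / 2), |g z - g y| ≤ N (z - y) := by
    intro y hy z hz
    have h1 : g z - g y = ∫ t, φ.normed μ t * (G (z - t) - G (y - t)) ∂μ := by
      simp only [g, convolution_def, ContinuousLinearMap.lsmul_apply, smul_eq_mul, mul_sub]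
      rw [integral_sub (hin z) (hin y)]
    rw [h1, ← Real.norm_eq_abs]
    have h2 : ∫ t, φ.normed μ t * N (z - y) ∂μ = N (z - y) := by
      rw [integral_mul_const, φ.integral_normed, one_mul]
    rw [← h2]
    -- A convolution averages translates with total weight one, and `z - t - (y - t) = z - y`, so
    -- the bound by `N` survives with the same constant.
    refine norm_integral_le_of_norm_le (φ.integrable_normed.mul_const _) (ae_of_all _ fun t ↦ ?_)
    rw [norm_mul, Real.norm_of_nonneg (φ.nonneg_normed t)]
    by_cases ht : t ∈ Metric.ball (0 : E) φ.rOut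
    · refine mul_le_mul_of_nonneg_left ?_ (φ.nonneg_normed t)
      have ht' : ‖t‖ < ρ / 2 := (mem_ball_zero_iff.1 ht).trans_le (min_le_right _ _)
      have hmem : ∀ x ∈ Metric.ball c (ρ / 2), x - t ∈ Metric.ball c ρ := fun x hx ↦ by
        rw [mem_ball_iff_norm] at hx ⊢
        calc ‖x - t - c‖ = ‖(x - c) - t‖ := by congr 1; abel
          _ ≤ ‖x - c‖ + ‖t‖ := norm_sub_le _ _
          _ < ρ := by linarith
      simpa using hlip _ (hmem y hy) _ (hmem z hz)
    · have : φ.normed μ t = 0 := by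
        rw [← Function.notMem_support, φ.support_normed_eq]; exact ht
      simp [this]
  refine ⟨g, hg, fun y hy ↦ ⟨?_, fun v ↦ ?_⟩⟩
  · rw [← Real.dist_eq]
    refine φ.dist_normed_convolution_le hG.aestronglyMeasurable fun x hx ↦ ?_
    have hx' : dist x y < min δ (ρ / 2) := hx
    refine hunif _ ?_ _ ?_ (hx'.le.trans (min_le_left _ _))
    · have := min_le_right δ (ρ / 2)
      have h3 := Metric.mem_ball.1 hy
      have := dist_triangle x y c
      exact Metric.mem_closedBall.2 (by linarith)
    · exact Metric.ball_subset_closedBall (Metric.ball_subset_ball (by linarith) hy)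
  · have hd : HasDerivAt (fun s : ℝ ↦ g (y + s • v)) (fderiv ℝ g y v) 0 := by
      have h1 : HasDerivAt (fun s : ℝ ↦ y + s • v) v 0 := by
        simpa using ((hasDerivAt_id (0 : ℝ)).smul_const v).const_add y
      have h2 : HasFDerivAt g (fderiv ℝ g y) (y + (0 : ℝ) • v) := by
        simpa using (hg.differentiable (by simp) y).hasFDerivAt
      exact h2.comp_hasDerivAt (0 : ℝ) h1
    -- The derivative along the line `y + s • v` is bounded by its Lipschitz constant, which
    -- homogeneity of `N` identifies as `N v`.
    refine hd.le_of_lip' (hN0 v) ?_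
    have hcont : Tendsto (fun s : ℝ ↦ y + s • v) (𝓝 0) (𝓝 y) := by
      have : Continuous (fun s : ℝ ↦ y + s • v) := by fun_prop
      simpa using this.tendsto 0
    filter_upwards [hcont.eventually (Metric.isOpen_ball.eventually_mem hy)] with s hs
    have := hgl y hy _ hs
    simpa [hN, mul_comm] using this

end Mollification

/-! ### Smoothing a Lipschitz function near a point -/

section LocalSmoothing

open Filter Topology

variable {n : ℕ} {M : Type*} [MetricSpace M]
  [ChartedSpace (EuclideanSpace ℝ (Fin n)) M]

/-- The derivative of a real function at `x` in the direction of the tangent vector `v`. -/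
noncomputable def directionalDeriv (h : M → ℝ) (x : M) (v : TangentSpace (𝓡 n) x) : ℝ :=
  mfderiv (𝓡 n) 𝓘(ℝ, ℝ) h x v

variable [IsManifold (𝓡 n) ∞ M]

theorem directionalDeriv_comp_chartAt {x₀ x : M} {g : EuclideanSpace ℝ (Fin n) → ℝ}
    (hx : x ∈ (chartAt (EuclideanSpace ℝ (Fin n)) x₀).source)
    (hg : DifferentiableAt ℝ g (chartAt (EuclideanSpace ℝ (Fin n)) x₀ x))
    (v : TangentSpace (𝓡 n) x) :
    directionalDeriv (g ∘ chartAt (EuclideanSpace ℝ (Fin n)) x₀) x v =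
      fderiv ℝ g (chartAt (EuclideanSpace ℝ (Fin n)) x₀ x)
        (mfderiv (𝓡 n) (𝓡 n) (chartAt (EuclideanSpace ℝ (Fin n)) x₀) x v) := by
  have : IsManifold (𝓡 n) 1 M := IsManifold.of_le (n := ∞) (by simp)
  rw [directionalDeriv, mfderiv_comp x hg.mdifferentiableAt
    (mdifferentiableAt_atlas (I := 𝓡 n) (chart_mem_atlas _ x₀) hx), mfderiv_eq_fderiv]
  rfl

variable [RiemannianBundle (fun x : M ↦ TangentSpace (𝓡 n) x)]

theorem norm_mfderiv_chartAt_symm_mfderiv_chartAt {x₀ x : M}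
    (hx : x ∈ (chartAt (EuclideanSpace ℝ (Fin n)) x₀).source) (v : TangentSpace (𝓡 n) x) :
    ‖mfderiv (𝓡 n) (𝓡 n) (chartAt (EuclideanSpace ℝ (Fin n)) x₀).symm
      (chartAt (EuclideanSpace ℝ (Fin n)) x₀ x)
      (mfderiv (𝓡 n) (𝓡 n) (chartAt (EuclideanSpace ℝ (Fin n)) x₀) x v)‖ = ‖v‖ := by
  have : IsManifold (𝓡 n) 1 M := IsManifold.of_le (n := ∞) (by simp)
  have h := (mdifferentiable_chart (I := 𝓡 n) x₀).symm_comp_deriv hx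
  have h2 : (mfderiv (𝓡 n) (𝓡 n) (chartAt (EuclideanSpace ℝ (Fin n)) x₀).symm
      (chartAt (EuclideanSpace ℝ (Fin n)) x₀ x)
      (mfderiv (𝓡 n) (𝓡 n) (chartAt (EuclideanSpace ℝ (Fin n)) x₀) x v) :
        EuclideanSpace ℝ (Fin n)) = v := congrArg (fun L ↦ L v) h
  have h3 : ∀ (m m' : M), m = m' → ∀ w : EuclideanSpace ℝ (Fin n),
      ‖(show TangentSpace (𝓡 n) m from w)‖ = ‖(show TangentSpace (𝓡 n) m' from w)‖ := by
    rintro m _ rfl w; rfl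
  exact (h3 _ _ ((chartAt (EuclideanSpace ℝ (Fin n)) x₀).left_inv hx) _).trans
    (congrArg (fun w : EuclideanSpace ℝ (Fin n) ↦ ‖(show TangentSpace (𝓡 n) x from w)‖) h2)

variable [IsContMDiffRiemannianBundle (𝓡 n) ∞ (EuclideanSpace ℝ (Fin n))
    (fun x : M ↦ TangentSpace (𝓡 n) x)]

/-- Mollification in the chart at `x₀`. The neighbourhood is chosen before `ε`: a partition of unity
subordinate to such sets can be fixed first, and the accuracy adapted to its derivatives afterwards.
The constant `4` is `2 * 2`, one factor for each direction of the comparison with `chartNorm x₀`. -/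
theorem exists_isOpen_forall_exists_contMDiffOn_approx [IsRiemannianManifold (𝓡 n) M]
    {f : M → ℝ} (hf : ∀ x y, |f x - f y| ≤ dist x y) (x₀ : M) :
    ∃ U : Set M, IsOpen U ∧ x₀ ∈ U ∧ ∀ ε > 0, ∃ h : M → ℝ,
      ContMDiffOn (𝓡 n) 𝓘(ℝ, ℝ) ∞ h U ∧
      ∀ x ∈ U, |h x - f x| ≤ ε ∧
        ∀ v : TangentSpace (𝓡 n) x, |directionalDeriv h x v| ≤ 4 * ‖v‖ := by
  obtain ⟨ρ, hρ, ht, hb⟩ := exists_ball_norm_mfderiv_chartAt_symm (n := n) x₀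
  obtain ⟨A, hA, hAN⟩ := exists_chartNorm_le (n := n) x₀
  have hlip : ∀ y ∈ Metric.ball (chartAt (EuclideanSpace ℝ (Fin n)) x₀ x₀) ρ,
      ∀ z ∈ Metric.ball (chartAt (EuclideanSpace ℝ (Fin n)) x₀ x₀) ρ,
      |f ((chartAt (EuclideanSpace ℝ (Fin n)) x₀).symm z) -
        f ((chartAt (EuclideanSpace ℝ (Fin n)) x₀).symm y)| ≤ 2 * chartNorm x₀ (z - y) :=
    fun y hy z hz ↦ ((hf _ _).trans_eq (dist_comm _ _)).trans
      (dist_chartAt_symm_le ht (fun y hy v ↦ (hb y hy v).1) hy hz)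
  have hL : LipschitzOnWith (2 * A).toNNReal (f ∘ (chartAt (EuclideanSpace ℝ (Fin n)) x₀).symm)
      (Metric.ball (chartAt (EuclideanSpace ℝ (Fin n)) x₀ x₀) ρ) := by
    refine LipschitzOnWith.of_dist_le_mul fun z hz y hy ↦ ?_
    rw [Real.coe_toNNReal _ (by positivity), Real.dist_eq, dist_eq_norm]
    have := hAN (z - y)
    exact (hlip y hy z hz).trans (by linarith)
  -- The coordinate expression of `f` is controlled only on the ball, while the mollification lemma
  -- takes a continuous function on the whole space.
  obtain ⟨G, hGL, hG⟩ := hL.extend_real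
  have hN : ∀ (c : ℝ) (v : EuclideanSpace ℝ (Fin n)),
      2 * chartNorm x₀ (c • v) = |c| * (2 * chartNorm x₀ v) := fun c v ↦ by
    rw [chartNorm_smul]; ring
  refine ⟨(chartAt (EuclideanSpace ℝ (Fin n)) x₀).source ∩ chartAt (EuclideanSpace ℝ (Fin n)) x₀ ⁻¹'
      Metric.ball (chartAt (EuclideanSpace ℝ (Fin n)) x₀ x₀) (ρ / 2),
    (chartAt (EuclideanSpace ℝ (Fin n)) x₀).isOpen_inter_preimage Metric.isOpen_ball,
    ⟨mem_chart_source _ x₀, Metric.mem_ball_self (by positivity)⟩, fun ε hε ↦ ?_⟩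
  obtain ⟨g, hg, hgG⟩ := exists_contDiff_dist_le_abs_fderiv_le hGL.continuous
    (N := fun v ↦ 2 * chartNorm x₀ v)
    (fun v ↦ mul_nonneg zero_le_two (chartNorm_nonneg x₀ v)) hN
    (fun y hy z hz ↦ by rw [← hG hy, ← hG hz]; exact hlip y hy z hz) hε hρ
  refine ⟨g ∘ chartAt (EuclideanSpace ℝ (Fin n)) x₀,
    hg.contMDiff.comp_contMDiffOn (contMDiffOn_chart.mono inter_subset_left),
    fun x hx ↦ ⟨?_, fun v ↦ ?_⟩⟩
  · have h1 := (hgG _ hx.2).1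
    rw [← hG (Metric.ball_subset_ball (by linarith) hx.2)] at h1
    simpa [(chartAt (EuclideanSpace ℝ (Fin n)) x₀).left_inv hx.1] using h1
  · rw [directionalDeriv_comp_chartAt hx.1 (hg.differentiable (by simp) _)]
    have h1 := (hgG _ hx.2).2 (mfderiv (𝓡 n) (𝓡 n) (chartAt (EuclideanSpace ℝ (Fin n)) x₀) x v)
    have h2 := (hb _ (Metric.ball_subset_ball (by linarith) hx.2)
      (mfderiv (𝓡 n) (𝓡 n) (chartAt (EuclideanSpace ℝ (Fin n)) x₀) x v)).2
    have h3 := norm_mfderiv_chartAt_symm_mfderiv_chartAt hx.1 v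
    refine h1.trans ?_
    linarith

end LocalSmoothing

/-! ### Bounds on derivatives over compact sets -/

section DerivativeBound

open Filter Topology

variable {n : ℕ} {M : Type*} [MetricSpace M]
  [ChartedSpace (EuclideanSpace ℝ (Fin n)) M] [IsManifold (𝓡 n) ∞ M]
  [RiemannianBundle (fun x : M ↦ TangentSpace (𝓡 n) x)]
  [IsContMDiffRiemannianBundle (𝓡 n) ∞ (EuclideanSpace ℝ (Fin n))
    (fun x : M ↦ TangentSpace (𝓡 n) x)]

/-- Naming the image vector `w` in `EuclideanSpace ℝ (Fin n)` makes `‖w‖` the Euclidean norm,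
whereas `‖v‖` is the Riemannian one. -/
theorem exists_eventually_norm_mfderiv_chartAt_le (x₀ : M) :
    ∃ C ≥ 0, ∀ᶠ x in 𝓝 x₀, ∀ (v : TangentSpace (𝓡 n) x) (w : EuclideanSpace ℝ (Fin n)),
      w = mfderiv (𝓡 n) (𝓡 n) (chartAt (EuclideanSpace ℝ (Fin n)) x₀) x v → ‖w‖ ≤ C * ‖v‖ := by
  have : IsContinuousRiemannianBundle (EuclideanSpace ℝ (Fin n))
      (fun x : M ↦ TangentSpace (𝓡 n) x) := isContinuousRiemannianBundle_tangentSpace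
  have : IsManifold (𝓡 n) 1 M := IsManifold.of_le (n := ∞) (by simp)
  obtain ⟨C, hC, h⟩ := eventually_norm_trivializationAt_lt (EuclideanSpace ℝ (Fin n))
    (fun x : M ↦ TangentSpace (𝓡 n) x) x₀
  refine ⟨C, hC.le, ?_⟩
  filter_upwards [h, (chartAt (EuclideanSpace ℝ (Fin n)) x₀).open_source.mem_nhds
    (mem_chart_source _ x₀)] with x hx hxs v w hw
  have h1 := ContinuousLinearMap.le_of_opNorm_le _ hx.le v
  have h2 : (trivializationAt (EuclideanSpace ℝ (Fin n)) (fun x : M ↦ TangentSpace (𝓡 n) x)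
      x₀).continuousLinearMapAt ℝ x v = w := by
    rw [TangentBundle.continuousLinearMapAt_trivializationAt (𝕜 := ℝ) (I := 𝓡 n) hxs, hw]
    rfl
  rwa [h2] at h1

theorem exists_eventually_abs_directionalDeriv_le {h : M → ℝ}
    (hh : ContMDiff (𝓡 n) 𝓘(ℝ, ℝ) ∞ h) (x₀ : M) :
    ∃ B ≥ 0, ∀ᶠ x in 𝓝 x₀, ∀ v : TangentSpace (𝓡 n) x, |directionalDeriv h x v| ≤ B * ‖v‖ := by
  obtain ⟨C, hC, hCx⟩ := exists_eventually_norm_mfderiv_chartAt_le (n := n) x₀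
  let e := chartAt (EuclideanSpace ℝ (Fin n)) x₀
  have hd : ContDiffOn ℝ ∞ (h ∘ e.symm) e.target :=
    contMDiffOn_iff_contDiffOn.1 (hh.comp_contMDiffOn (contMDiffOn_chart_symm (I := 𝓡 n)))
  have hcont : ContinuousOn (fderiv ℝ (h ∘ e.symm)) e.target :=
    hd.continuousOn_fderiv_of_isOpen e.open_target (by simp)
  have h1 : ContinuousAt (fun x ↦ ‖fderiv ℝ (h ∘ e.symm) (e x)‖) x₀ :=
    ((hcont.continuousAt (e.open_target.mem_nhds (mem_chart_target _ x₀))).comp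
      (e.continuousAt (mem_chart_source _ x₀))).norm
  set B := ‖fderiv ℝ (h ∘ e.symm) (e x₀)‖ + 1
  have h2 : ∀ᶠ x in 𝓝 x₀, ‖fderiv ℝ (h ∘ e.symm) (e x)‖ < B :=
    h1.eventually_lt continuousAt_const (by simp [B])
  refine ⟨B * C, by positivity, ?_⟩
  filter_upwards [hCx, h2, e.open_source.mem_nhds (mem_chart_source _ x₀)] with x hx1 hx2 hxs v
  have heq : h =ᶠ[𝓝 x] (h ∘ e.symm) ∘ e := by
    filter_upwards [e.open_source.mem_nhds hxs] with y hy
    simp [e.left_inv hy]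
  have h3 : directionalDeriv h x v = directionalDeriv ((h ∘ e.symm) ∘ e) x v :=
    congrArg (fun L : EuclideanSpace ℝ (Fin n) →L[ℝ] ℝ ↦ L v) (heq.mfderiv_eq (I := 𝓡 n))
  rw [h3, directionalDeriv_comp_chartAt hxs
    ((hd.differentiableOn (by simp)).differentiableAt (e.open_target.mem_nhds (e.map_source hxs)))]
  have h4 : ∀ w : EuclideanSpace ℝ (Fin n), ‖w‖ ≤ C * ‖v‖ →
      |fderiv ℝ (h ∘ e.symm) (e x) w| ≤ B * C * ‖v‖ := fun w hw ↦ by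
    rw [mul_assoc]
    exact ((fderiv ℝ (h ∘ e.symm) (e x)).le_opNorm w).trans
      (mul_le_mul hx2.le hw (norm_nonneg _) (by positivity))
  exact h4 _ (hx1 v _ rfl)

/-- Applied to the functions of a partition of unity, whose derivatives enter the gluing error.
Compactness turns the local bounds into a single one. -/
theorem exists_forall_mem_abs_directionalDeriv_le {h : M → ℝ}
    (hh : ContMDiff (𝓡 n) 𝓘(ℝ, ℝ) ∞ h) {K : Set M} (hK : IsCompact K) :
    ∃ B ≥ 0, ∀ x ∈ K, ∀ v : TangentSpace (𝓡 n) x, |directionalDeriv h x v| ≤ B * ‖v‖ := by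
  refine hK.induction_on (p := fun s ↦ ∃ B ≥ 0, ∀ x ∈ s, ∀ v : TangentSpace (𝓡 n) x,
    |directionalDeriv h x v| ≤ B * ‖v‖) ⟨0, le_rfl, by simp⟩ ?_ ?_ ?_
  · rintro s t hst ⟨B, hB, h⟩
    exact ⟨B, hB, fun x hx ↦ h x (hst hx)⟩
  · rintro s t ⟨B, hB, h⟩ ⟨B', hB', h'⟩
    refine ⟨max B B', le_max_of_le_left hB, ?_⟩
    rintro x (hx | hx) v
    · exact (h x hx v).trans (by gcongr; exact le_max_left _ _)
    · exact (h' x hx v).trans (by gcongr; exact le_max_right _ _)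
  · intro x _
    obtain ⟨B, hB, h⟩ := exists_eventually_abs_directionalDeriv_le hh x
    exact ⟨_, mem_nhdsWithin_of_mem_nhds h, B, hB, fun y hy ↦ hy⟩

end DerivativeBound

/-! ### Gluing the local smoothings by a partition of unity -/

section GlobalSmoothing

open Filter Topology

variable {n : ℕ} {M : Type*} [MetricSpace M]
  [ChartedSpace (EuclideanSpace ℝ (Fin n)) M]

theorem directionalDeriv_congr {g h : M → ℝ} {x : M} (hgh : g =ᶠ[𝓝 x] h)
    (v : TangentSpace (𝓡 n) x) : directionalDeriv g x v = directionalDeriv h x v :=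
  congrArg (fun L : EuclideanSpace ℝ (Fin n) →L[ℝ] ℝ ↦ L v) (hgh.mfderiv_eq (I := 𝓡 n))

theorem directionalDeriv_mul {g h : M → ℝ} {x : M} (hg : MDifferentiableAt (𝓡 n) 𝓘(ℝ, ℝ) g x)
    (hh : MDifferentiableAt (𝓡 n) 𝓘(ℝ, ℝ) h x) (v : TangentSpace (𝓡 n) x) :
    directionalDeriv (fun y ↦ g y * h y) x v =
      g x * directionalDeriv h x v + h x * directionalDeriv g x v :=
  congrArg (fun L : EuclideanSpace ℝ (Fin n) →L[ℝ] ℝ ↦ L v)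
    (hg.hasMFDerivAt.mul hh.hasMFDerivAt).mfderiv

theorem directionalDeriv_const (c : ℝ) (x : M) (v : TangentSpace (𝓡 n) x) :
    directionalDeriv (fun _ : M ↦ c) x v = 0 :=
  congrArg (fun L : EuclideanSpace ℝ (Fin n) →L[ℝ] ℝ ↦ L v)
    (hasMFDerivAt_const (I := 𝓡 n) (I' := 𝓘(ℝ, ℝ)) c x).mfderiv

theorem directionalDeriv_add {g h : M → ℝ} {x : M} (hg : MDifferentiableAt (𝓡 n) 𝓘(ℝ, ℝ) g x)
    (hh : MDifferentiableAt (𝓡 n) 𝓘(ℝ, ℝ) h x) (v : TangentSpace (𝓡 n) x) :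
    directionalDeriv (fun y ↦ g y + h y) x v = directionalDeriv g x v + directionalDeriv h x v :=
  congrArg (fun L : EuclideanSpace ℝ (Fin n) →L[ℝ] ℝ ↦ L v)
    (hg.hasMFDerivAt.add hh.hasMFDerivAt).mfderiv

theorem directionalDeriv_add_const {g : M → ℝ} {x : M}
    (hg : MDifferentiableAt (𝓡 n) 𝓘(ℝ, ℝ) g x) (c : ℝ) (v : TangentSpace (𝓡 n) x) :
    directionalDeriv (fun y ↦ g y + c) x v = directionalDeriv g x v := by
  rw [directionalDeriv_add hg mdifferentiableAt_const, directionalDeriv_const, add_zero]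

theorem mdifferentiableAt_sum_and_directionalDeriv_sum {ι : Type*} {t : Finset ι}
    {g : ι → M → ℝ} {x : M} (hg : ∀ i ∈ t, MDifferentiableAt (𝓡 n) 𝓘(ℝ, ℝ) (g i) x) :
    MDifferentiableAt (𝓡 n) 𝓘(ℝ, ℝ) (fun y ↦ ∑ i ∈ t, g i y) x ∧
      ∀ v : TangentSpace (𝓡 n) x,
        directionalDeriv (fun y ↦ ∑ i ∈ t, g i y) x v = ∑ i ∈ t, directionalDeriv (g i) x v := by
  classical
  induction t using Finset.induction_on with
  | empty => simpa using ⟨mdifferentiableAt_const, directionalDeriv_const 0 x⟩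
  | insert i s hi ih =>
    have h1 := hg i (Finset.mem_insert_self i s)
    obtain ⟨h2, h3⟩ := ih fun j hj ↦ hg j (Finset.mem_insert_of_mem hj)
    simp only [Finset.sum_insert hi]
    exact ⟨h1.add h2, fun v ↦ by rw [directionalDeriv_add h1 h2, h3]⟩

theorem directionalDeriv_comp {g : M → ℝ} {η : ℝ → ℝ} {x : M}
    (hη : DifferentiableAt ℝ η (g x)) (hg : MDifferentiableAt (𝓡 n) 𝓘(ℝ, ℝ) g x)
    (v : TangentSpace (𝓡 n) x) :
    directionalDeriv (fun y ↦ η (g y)) x v = deriv η (g x) * directionalDeriv g x v := by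
  have h := congrArg (fun L : EuclideanSpace ℝ (Fin n) →L[ℝ] ℝ ↦ L v)
    (mfderiv_comp x hη.mdifferentiableAt hg)
  refine h.trans ?_
  rw [mfderiv_eq_fderiv]
  refine (fderiv_eq_smul_deriv (f := η) (x := g x) (y := directionalDeriv g x v)).trans ?_
  simp [mul_comm]

variable [IsManifold (𝓡 n) ∞ M] [RiemannianBundle (fun x : M ↦ TangentSpace (𝓡 n) x)]
  [IsContMDiffRiemannianBundle (𝓡 n) ∞ (EuclideanSpace ℝ (Fin n))
    (fun x : M ↦ TangentSpace (𝓡 n) x)]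

/-- A `1`-Lipschitz function can be smoothed on a compact set with control of the gradient. -/
theorem exists_contMDiff_approx_on_compact [IsRiemannianManifold (𝓡 n) M]
    [SecondCountableTopology M] {f : M → ℝ} (hf : ∀ x y, |f x - f y| ≤ dist x y) {K : Set M}
    (hK : IsCompact K) {ε : ℝ} (hε : 0 < ε) :
    ∃ g : M → ℝ, ContMDiff (𝓡 n) 𝓘(ℝ, ℝ) ∞ g ∧ (∀ x ∈ K, |g x - f x| ≤ ε) ∧
      (∀ x, |g x| ≤ |f x| + ε) ∧
      ∀ x ∈ interior K, ∀ v : TangentSpace (𝓡 n) x, |directionalDeriv g x v| ≤ 5 * ‖v‖ := by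
  have : LocallyCompactSpace M := ChartedSpace.locallyCompactSpace (EuclideanSpace ℝ (Fin n)) M
  choose U hUo hxU hU using exists_isOpen_forall_exists_contMDiffOn_approx (n := n) hf
  obtain ⟨t, -, htK⟩ := hK.elim_nhds_subcover U fun x _ ↦ (hUo x).mem_nhds (hxU x)
  obtain ⟨ρ, hρ⟩ := SmoothPartitionOfUnity.exists_isSubordinate (𝓡 n) hK.isClosed
    (fun i : t ↦ U i) (fun i ↦ hUo i) (by
      intro x hx
      obtain ⟨i, hi, hxi⟩ := mem_iUnion₂.1 (htK hx)
      exact mem_iUnion.2 ⟨⟨i, hi⟩, hxi⟩)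
  choose B hB0 hB using fun i : t ↦
    exists_forall_mem_abs_directionalDeriv_le (n := n) (ρ i).contMDiff hK
  have hBs : 0 ≤ ∑ i, B i := Finset.sum_nonneg fun i _ ↦ hB0 i
  -- The terms where the derivative falls on the partition functions add up to at most `δ * ∑ i, B
  -- i` times `‖v‖`; keeping this below `1` turns the local constant `4` into `5`.
  obtain ⟨δ, hδ, hδε, hδB⟩ : ∃ δ > 0, δ ≤ ε ∧ δ * ∑ i, B i ≤ 1 := by
    refine ⟨min ε (1 / (∑ i, B i + 1)), by positivity, min_le_left _ _, ?_⟩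
    calc _ ≤ (1 / (∑ i, B i + 1)) * ∑ i, B i := by gcongr; exact min_le_right _ _
      _ ≤ 1 := by rw [one_div, inv_mul_le_iff₀ (by positivity)]; linarith
  choose h hhs hh using fun i : t ↦ hU i δ hδ
  have hmem : ∀ i x, ρ i x ≠ 0 → x ∈ U i := fun i x hx ↦ hρ i (subset_tsupport _ hx)
  have hsum1 : ∀ x ∈ K, ∑ i, ρ i x = 1 := fun x hx ↦ by
    rw [← finsum_eq_sum_of_fintype]; exact ρ.sum_eq_one hx
  have hsum : ∀ x, ∑ i, ρ i x ≤ 1 := fun x ↦ by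
    rw [← finsum_eq_sum_of_fintype]; exact ρ.sum_le_one x
  have hclose : ∀ x, |∑ i, ρ i x * (h i x - f x)| ≤ ε := fun x ↦ by
    calc _ ≤ ∑ i, |ρ i x * (h i x - f x)| := Finset.abs_sum_le_sum_abs _ _
      _ ≤ ∑ i, ρ i x * δ := by
        refine Finset.sum_le_sum fun i _ ↦ ?_
        rw [abs_mul, abs_of_nonneg (ρ.nonneg i x)]
        by_cases h0 : ρ i x = 0
        · simp [h0]
        · exact mul_le_mul_of_nonneg_left (hh i x (hmem i x h0)).1 (ρ.nonneg i x)
      _ = (∑ i, ρ i x) * δ := by rw [Finset.sum_mul]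
      _ ≤ 1 * δ := by gcongr; exact hsum x
      _ ≤ ε := by linarith
  have hsplit : ∀ x, ∑ i, ρ i x * h i x = ∑ i, ρ i x * (h i x - f x) + (∑ i, ρ i x) * f x :=
    fun x ↦ by rw [Finset.sum_mul, ← Finset.sum_add_distrib]; congr! 1; ring
  refine ⟨fun x ↦ ∑ i, ρ i x * h i x, ?_, fun x hx ↦ ?_, fun x ↦ ?_, fun x hx v ↦ ?_⟩
  · have := hρ.contMDiff_finsum_smul (g := h) (fun i ↦ hUo i) hhs
    simpa only [finsum_eq_sum_of_fintype, smul_eq_mul] using this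
  · beta_reduce
    rw [hsplit, hsum1 x hx]
    simpa using hclose x
  · beta_reduce
    rw [hsplit, add_comm]
    refine (abs_add_le _ _).trans (add_le_add ?_ (hclose x))
    rw [abs_mul, abs_of_nonneg (Finset.sum_nonneg fun i _ ↦ ρ.nonneg i x)]
    exact mul_le_of_le_one_left (abs_nonneg _) (hsum x)
  -- The weights sum to one near an interior point `x` of `K`, so the number `f x` may be subtracted
  -- from each `h i`. In the product rule the derivative of `ρ i` is then multiplied by the small
  -- number `h i x - f x`, and `f` itself is never differentiated.
  · have heq : (fun y ↦ ∑ i, ρ i y * h i y) =ᶠ[𝓝 x]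
        fun y ↦ ∑ i, ρ i y * (h i y - f x) + f x := by
      filter_upwards [mem_interior_iff_mem_nhds.1 hx] with y hy
      simp only [mul_sub, Finset.sum_sub_distrib, ← Finset.sum_mul, hsum1 y hy]
      ring
    have hxK := interior_subset hx
    have hterm : ∀ i, MDifferentiableAt (𝓡 n) 𝓘(ℝ, ℝ) (fun y ↦ ρ i y * (h i y - f x)) x ∧
        |directionalDeriv (fun y ↦ ρ i y * (h i y - f x)) x v| ≤
          ρ i x * (4 * ‖v‖) + δ * (B i * ‖v‖) := by
      intro i
      have hnn : 0 ≤ ρ i x * (4 * ‖v‖) + δ * (B i * ‖v‖) := by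
        have := ρ.nonneg i x
        have := hB0 i
        positivity
      -- Smoothness of `h i` is known only on `U i`; off the support of `ρ i` the whole term
      -- vanishes near `x`.
      by_cases hxt : x ∈ tsupport (ρ i)
      · have hxU' := hρ i hxt
        have d1 : MDifferentiableAt (𝓡 n) 𝓘(ℝ, ℝ) (ρ i) x :=
          (ρ i).contMDiff.mdifferentiableAt (by simp)
        have d2 : MDifferentiableAt (𝓡 n) 𝓘(ℝ, ℝ) (h i) x :=
          ((hhs i).contMDiffAt ((hUo i).mem_nhds hxU')).mdifferentiableAt (by simp)
        have d3 : MDifferentiableAt (𝓡 n) 𝓘(ℝ, ℝ) (fun y ↦ h i y + -f x) x :=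
          d2.add mdifferentiableAt_const
        simp only [sub_eq_add_neg]
        refine ⟨d1.mul d3, ?_⟩
        rw [directionalDeriv_mul d1 d3, directionalDeriv_add_const d2, ← sub_eq_add_neg]
        refine (abs_add_le _ _).trans ?_
        rw [abs_mul, abs_mul, abs_of_nonneg (ρ.nonneg i x)]
        exact add_le_add (mul_le_mul_of_nonneg_left ((hh i x hxU').2 v) (ρ.nonneg i x))
          (mul_le_mul (hh i x hxU').1 (hB i x hxK v) (abs_nonneg _) hδ.le)
      · have h0 : (fun y ↦ ρ i y * (h i y - f x)) =ᶠ[𝓝 x] fun _ ↦ 0 := by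
          filter_upwards [notMem_tsupport_iff_eventuallyEq.1 hxt] with y hy
          simp [hy]
        refine ⟨mdifferentiableAt_const.congr_of_eventuallyEq h0, ?_⟩
        rw [directionalDeriv_congr h0, directionalDeriv_const, abs_zero]
        exact hnn
    obtain ⟨hd, hds⟩ := mdifferentiableAt_sum_and_directionalDeriv_sum (t := Finset.univ)
      (g := fun i y ↦ ρ i y * (h i y - f x)) fun i _ ↦ (hterm i).1
    rw [directionalDeriv_congr heq, directionalDeriv_add_const hd, hds]
    calc _ ≤ ∑ i, (ρ i x * (4 * ‖v‖) + δ * (B i * ‖v‖)) :=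
          (Finset.abs_sum_le_sum_abs _ _).trans (Finset.sum_le_sum fun i _ ↦ (hterm i).2)
      _ = (∑ i, ρ i x) * (4 * ‖v‖) + (δ * ∑ i, B i) * ‖v‖ := by
          rw [Finset.sum_add_distrib, Finset.sum_mul, mul_assoc, Finset.sum_mul, Finset.mul_sum]
      _ ≤ 1 * (4 * ‖v‖) + 1 * ‖v‖ := by gcongr; exact hsum x
      _ = 5 * ‖v‖ := by ring

end GlobalSmoothing

/-! ### Length-space properties, connected balls and Hopf–Rinow -/

section LengthSpace

open Filter Topology Manifold

variable {n : ℕ} {M : Type*} [MetricSpace M]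
  [ChartedSpace (EuclideanSpace ℝ (Fin n)) M] [IsManifold (𝓡 n) ∞ M]
  [RiemannianBundle (fun x : M ↦ TangentSpace (𝓡 n) x)]
  [IsRiemannianManifold (𝓡 n) M]

include n in
-- A substitute for minimizing geodesics: on a path from `x` to `y` of length less than `r + s`,
-- take a point at distance exactly `r` from `x`; less than `s` of length remains.
theorem exists_dist_le_dist_lt_of_dist_lt_add {x y : M} {r s : ℝ} (hr : 0 ≤ r) (hs : 0 < s)
    (h : dist x y < r + s) : ∃ z, dist x z ≤ r ∧ dist z y < s := by
  have : IsManifold (𝓡 n) 1 M := IsManifold.of_le (n := ∞) (by simp)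
  rcases le_or_gt (dist x y) r with hle | hgt
  · exact ⟨y, hle, by simpa using hs⟩
  have h1 : riemannianEDist (𝓡 n) x y < ENNReal.ofReal (r + s) := by
    rw [← IsRiemannianManifold.out (I := 𝓡 n) x y, edist_dist]
    exact (ENNReal.ofReal_lt_ofReal_iff (by linarith)).2 h
  obtain ⟨γ, h0, h1, hγ, hl⟩ := exists_lt_of_riemannianEDist_lt h1
  have hc : ContinuousOn (fun t ↦ dist x (γ t)) (Icc 0 1) :=
    (continuous_const.dist continuous_id).comp_continuousOn hγ.continuousOn
  obtain ⟨t, ht, htr⟩ := intermediate_value_Icc zero_le_one hc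
    (show r ∈ Icc _ _ from ⟨by simpa [h0] using hr, by simpa [h1] using hgt.le⟩)
  have hadd := pathELength_add (I := 𝓡 n) (γ := γ) ht.1 ht.2
  have e1 : ENNReal.ofReal r ≤ pathELength (𝓡 n) γ 0 t := by
    rw [← htr, ← edist_dist, IsRiemannianManifold.out (I := 𝓡 n) x (γ t)]
    exact riemannianEDist_le_pathELength (hγ.mono (Icc_subset_Icc_right ht.2)) h0 rfl ht.1
  have e2 : edist (γ t) y ≤ pathELength (𝓡 n) γ t 1 := by
    rw [IsRiemannianManifold.out (I := 𝓡 n) (γ t) y]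
    exact riemannianEDist_le_pathELength (hγ.mono (Icc_subset_Icc_left ht.1)) rfl h1 ht.2
  refine ⟨γ t, htr.le, ?_⟩
  have e3 : ENNReal.ofReal r + edist (γ t) y < ENNReal.ofReal r + ENNReal.ofReal s := by
    rw [← ENNReal.ofReal_add hr hs.le]
    exact (add_le_add e1 e2).trans_lt (hadd.trans_lt hl)
  rw [ENNReal.add_lt_add_iff_left ENNReal.ofReal_ne_top, edist_dist,
    ENNReal.ofReal_lt_ofReal_iff hs] at e3
  exact e3

include n in
-- A path of length less than `r` starting at `x` cannot leave the ball.
theorem isPreconnected_ball_of_isRiemannianManifold (x : M) (r : ℝ) :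
    IsPreconnected (Metric.ball x r) := by
  have : IsManifold (𝓡 n) 1 M := IsManifold.of_le (n := ∞) (by simp)
  refine isPreconnected_of_forall x fun y hy ↦ ?_
  have hr : 0 < r := dist_nonneg.trans_lt hy
  have h1 : riemannianEDist (𝓡 n) x y < ENNReal.ofReal r := by
    rw [← IsRiemannianManifold.out (I := 𝓡 n) x y, edist_dist]
    exact (ENNReal.ofReal_lt_ofReal_iff hr).2 (Metric.mem_ball'.1 hy)
  obtain ⟨γ, h0, h1, hγ, hl⟩ := exists_lt_of_riemannianEDist_lt h1
  refine ⟨γ '' Icc 0 1, ?_, ⟨0, by simp, h0⟩, ⟨1, by simp, h1⟩,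
    isPreconnected_Icc.image _ hγ.continuousOn⟩
  rintro _ ⟨t, ht, rfl⟩
  have e1 : edist x (γ t) < ENNReal.ofReal r := by
    rw [IsRiemannianManifold.out (I := 𝓡 n) x (γ t)]
    exact (riemannianEDist_le_pathELength (hγ.mono (Icc_subset_Icc_right ht.2)) h0 rfl
      ht.1).trans_lt ((pathELength_mono le_rfl ht.2).trans_lt hl)
  rw [edist_dist, ENNReal.ofReal_lt_ofReal_iff hr] at e1
  exact Metric.mem_ball'.2 e1

include n in
/-- **Hopf–Rinow**: closed balls of a complete Riemannian manifold are compact. -/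
theorem isCompact_closedBall_of_isRiemannianManifold [CompleteSpace M] (x : M) (r : ℝ) :
    IsCompact (Metric.closedBall x r) := by
  have : LocallyCompactSpace M := ChartedSpace.locallyCompactSpace (EuclideanSpace ℝ (Fin n)) M
  rcases lt_or_ge r 0 with hr | hr
  · simp [Metric.closedBall_eq_empty.2 hr]
  -- Continuity induction on the radius: compactness passes to limits of radii and extends to
  -- slightly larger radii.
  let S : Set ℝ := {t | IsCompact (Metric.closedBall x t)}
  suffices Icc 0 r ⊆ S from this ⟨hr, le_rfl⟩
  refine IsClosed.Icc_subset_of_forall_exists_gt ?_ (by simp [S]) ?_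
  -- For a good radius `t'` within `ε / 2` of `t`, every point of the ball of radius `t` is within
  -- `ε / 2` of the ball of radius `t'`, so a finite `ε / 2`-net of the latter is an `ε`-net of the
  -- former. Completeness of `M` then gives compactness.
  · refine isClosed_of_closure_subset fun t ht ↦ ⟨?_, ?_⟩
    · refine isCompact_iff_totallyBounded_isComplete.2
        ⟨Metric.totallyBounded_iff.2 fun ε hε ↦ ?_, Metric.isClosed_closedBall.isComplete⟩
      obtain ⟨t', ⟨ht'S, ht'0, -⟩, htt'⟩ := Metric.mem_closure_iff.1 ht (ε / 2) (by positivity)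
      obtain ⟨F, hF, hcov⟩ := Metric.totallyBounded_iff.1
        (show IsCompact (Metric.closedBall x t') from ht'S).totallyBounded (ε / 2) (by positivity)
      refine ⟨F, hF, fun y hy ↦ ?_⟩
      have h1 : dist x y < t' + ε / 2 := by
        have := (abs_lt.1 htt').2
        have := Metric.mem_closedBall'.1 hy
        linarith
      obtain ⟨z, hz, hzy⟩ := exists_dist_le_dist_lt_of_dist_lt_add (n := n) ht'0 (by positivity) h1
      obtain ⟨w, hw, hzw⟩ := mem_iUnion₂.1 (hcov (Metric.mem_closedBall'.2 hz))
      refine mem_iUnion₂.2 ⟨w, hw, ?_⟩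
      have := dist_triangle_left y w z
      have := Metric.mem_ball.1 hzw
      exact Metric.mem_ball.2 (by linarith)
    · exact closure_minimal inter_subset_right isClosed_Icc ht
  · rintro t ⟨htS, ht0, -⟩ y hy
    -- By local compactness some closed thickening of the compact ball is compact, and it contains
    -- the closed ball of radius `t + δ / 2`.
    obtain ⟨δ, hδ, hc⟩ := (show IsCompact (Metric.closedBall x t) from htS).exists_isCompact_cthickening
    refine ⟨min y (t + δ / 2), ?_, lt_min hy (by linarith), min_le_left _ _⟩
    refine hc.of_isClosed_subset Metric.isClosed_closedBall fun w hw ↦ ?_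
    have h1 : dist x w < t + δ := by
      have := Metric.mem_closedBall'.1 hw
      have := min_le_right y (t + δ / 2)
      linarith
    obtain ⟨z, hz, hzw⟩ := exists_dist_le_dist_lt_of_dist_lt_add (n := n) ht0 hδ h1
    exact Metric.mem_cthickening_of_dist_le w z δ _ (Metric.mem_closedBall'.2 hz)
      (by rw [dist_comm]; exact hzw.le)

end LengthSpace

/-! ### Cutoff functions -/

section Cutoff

open Filter Topology

/-- The number `C` depends on nothing; it is how the cutoff enters the final `C₁`. -/
theorem exists_abs_deriv_smoothTransition_le :
    ∃ C > 0, ∀ t, |deriv Real.smoothTransition t| ≤ C := by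
  have hc : Continuous (deriv Real.smoothTransition) :=
    (Real.smoothTransition.contDiff (n := 1)).continuous_deriv le_rfl
  obtain ⟨C, hC⟩ := (isCompact_Icc (a := (0 : ℝ)) (b := 1)).exists_bound_of_continuousOn
    hc.continuousOn
  refine ⟨max C 1, by positivity, fun t ↦ ?_⟩
  by_cases ht : t ∈ Icc (0 : ℝ) 1
  · exact (hC t ht).trans (le_max_left _ _)
  · have h0 : deriv Real.smoothTransition t = 0 := by
      rw [mem_Icc, not_and_or, not_le, not_le] at ht
      rcases ht with ht | ht
      · have : Real.smoothTransition =ᶠ[𝓝 t] fun _ ↦ 0 := by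
          filter_upwards [gt_mem_nhds ht] with s hs
          exact Real.smoothTransition.zero_of_nonpos hs.le
        rw [this.deriv_eq, deriv_const]
      · have : Real.smoothTransition =ᶠ[𝓝 t] fun _ ↦ 1 := by
          filter_upwards [lt_mem_nhds ht] with s hs
          exact Real.smoothTransition.one_of_one_le hs.le
        rw [this.deriv_eq, deriv_const]
    rw [h0, abs_zero]
    positivity

variable {n : ℕ} {M : Type*} [MetricSpace M]
  [ChartedSpace (EuclideanSpace ℝ (Fin n)) M] [IsManifold (𝓡 n) ∞ M]
  [RiemannianBundle (fun x : M ↦ TangentSpace (𝓡 n) x)]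
  [IsContMDiffRiemannianBundle (𝓡 n) ∞ (EuclideanSpace ℝ (Fin n))
    (fun x : M ↦ TangentSpace (𝓡 n) x)]
  [IsRiemannianManifold (𝓡 n) M]

/-- Smooth cutoff functions between concentric balls, with a universal gradient bound. -/
theorem exists_contMDiff_cutoff [CompleteSpace M] [SecondCountableTopology M] {C : ℝ}
    (hC : ∀ t, |deriv Real.smoothTransition t| ≤ C) (x₀ : M) {r : ℝ} (hr : 0 < r) :
    ∃ φ : M → ℝ, ContMDiff (𝓡 n) 𝓘(ℝ, ℝ) ∞ φ ∧
      tsupport φ ⊆ Metric.closedBall x₀ (3 * r / 4) ∧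
      (∀ x ∈ Metric.ball x₀ (r / 2), φ x = 1) ∧
      ∀ x, ∀ v : TangentSpace (𝓡 n) x, |directionalDeriv φ x v| ≤ 40 * C / r * ‖v‖ := by
  have hf : ∀ x y : M, |max (3 * r / 4 - dist x x₀) 0 - max (3 * r / 4 - dist y x₀) 0| ≤
      dist x y := fun x y ↦ by
    refine (abs_max_sub_max_le_abs _ _ _).trans ?_
    rw [sub_sub_sub_cancel_left, ← Real.dist_eq, dist_comm x y]
    exact dist_dist_dist_le_left y x x₀
  obtain ⟨g, hg, hgf, hg0, hgd⟩ := exists_contMDiff_approx_on_compact (n := n) hf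
    (isCompact_closedBall_of_isRiemannianManifold (n := n) x₀ r) (ε := r / 16) (by positivity)
  -- `g` is within `r / 16` of the truncated distance on the closed ball of radius `r`. Hence `g ≥ 3
  -- * r / 16` on the ball of radius `r / 2`, where that function exceeds `r / 4`, and `|g| ≤ r /
  -- 16` beyond radius `3 * r / 4`, where it is zero. So `η` rises from `0` to `1` between these two
  -- values; its slope is at most `8 * C / r`, which times the gradient bound `5` of `g` makes `40 *
  -- C / r`.
  let η : ℝ → ℝ := fun t ↦ Real.smoothTransition ((t - r / 16) / (r / 8))
  have hηd : ∀ t, HasDerivAt η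
      (deriv Real.smoothTransition ((t - r / 16) / (r / 8)) * (1 / (r / 8))) t := fun t ↦ by
    have h1 : HasDerivAt (fun t : ℝ ↦ (t - r / 16) / (r / 8)) (1 / (r / 8)) t :=
      ((hasDerivAt_id t).sub_const _).div_const _
    exact ((Real.smoothTransition.contDiffAt (n := 1)).differentiableAt
      (by simp)).hasDerivAt.comp t h1
  have hηs : ContDiff ℝ ∞ η := Real.smoothTransition.contDiff.comp (by fun_prop)
  have hη0 : ∀ t ≤ r / 16, η t = 0 := fun t ht ↦
    Real.smoothTransition.zero_of_nonpos (div_nonpos_of_nonpos_of_nonneg (by linarith)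
      (by positivity))
  have hη1 : ∀ t, 3 * r / 16 ≤ t → η t = 1 := fun t ht ↦
    Real.smoothTransition.one_of_one_le (by rw [le_div_iff₀ (by positivity)]; linarith)
  have hsupp : tsupport (fun x ↦ η (g x)) ⊆ Metric.closedBall x₀ (3 * r / 4) := by
    refine closure_minimal (fun x hx ↦ ?_) Metric.isClosed_closedBall
    by_contra hx'
    refine hx (hη0 _ ((le_abs_self _).trans ((hg0 x).trans_eq ?_)))
    rw [Metric.mem_closedBall, not_le] at hx'
    rw [max_eq_right (by linarith)]
    simp
  have hC0 : 0 ≤ C := (abs_nonneg _).trans (hC 0)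
  refine ⟨fun x ↦ η (g x), hηs.contMDiff.comp hg, hsupp, fun x hx ↦ hη1 _ ?_, fun x v ↦ ?_⟩
  · have h1 := Metric.mem_ball.1 hx
    have h2 := hgf x (Metric.mem_closedBall.2 (by linarith))
    have h3 := le_max_left (3 * r / 4 - dist x x₀) 0
    have := (abs_le.1 h2).1
    linarith
  · by_cases hx : x ∈ tsupport (fun x ↦ η (g x))
    · have hxi : x ∈ interior (Metric.closedBall x₀ r) :=
        Metric.ball_subset_interior_closedBall
          (Metric.closedBall_subset_ball (by linarith) (hsupp hx))
      rw [directionalDeriv_comp (hηd _).differentiableAt (hg.mdifferentiableAt (by simp)),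
        (hηd _).deriv, abs_mul, abs_mul, abs_of_pos (a := 1 / (r / 8)) (by positivity)]
      calc _ ≤ C * (1 / (r / 8)) * (5 * ‖v‖) := by
            gcongr
            · exact hC _
            · exact hgd x hxi v
        _ = 40 * C / r * ‖v‖ := by field_simp; ring
    · have h0 : (fun x ↦ η (g x)) =ᶠ[𝓝 x] fun _ ↦ 0 := notMem_tsupport_iff_eventuallyEq.1 hx
      rw [directionalDeriv_congr h0, directionalDeriv_const, abs_zero]
      positivity

end Cutoff

/-! ### Lower bound for the volume of small balls -/

section LocalVolume

open Filter Topology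

theorem det_gram_single_pos {n : ℕ} {T : Type*} [NormedAddCommGroup T] [InnerProductSpace ℝ T]
    (L : EuclideanSpace ℝ (Fin n) →L[ℝ] T) (hL : Function.Injective L) :
    0 < (Matrix.of fun a b : Fin n ↦ (inner ℝ (L (EuclideanSpace.single a (1 : ℝ)))
      (L (EuclideanSpace.single b (1 : ℝ))) : ℝ)).det := by
  have h1 := (EuclideanSpace.basisFun (Fin n) ℝ).toBasis.linearIndependent
  have h2 := h1.map' (L : EuclideanSpace ℝ (Fin n) →ₗ[ℝ] T) (LinearMap.ker_eq_bot.2 hL)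
  have h3 := (Matrix.posDef_gram_of_linearIndependent h2).det_pos
  refine h3.trans_eq (congrArg Matrix.det ?_)
  ext a b
  simp [Matrix.gram_apply]

variable {n : ℕ} {M : Type*} [MetricSpace M]
  [ChartedSpace (EuclideanSpace ℝ (Fin n)) M] [IsManifold (𝓡 n) ∞ M]
  [RiemannianBundle (fun x : M ↦ TangentSpace (𝓡 n) x)]

theorem det_chartGram_pos (x₀ : M) :
    0 < (chartGram x₀ (chartAt (EuclideanSpace ℝ (Fin n)) x₀ x₀)).det := by
  have : IsManifold (𝓡 n) 1 M := IsManifold.of_le (n := ∞) (by simp)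
  have h := (mdifferentiable_chart (I := 𝓡 n) x₀).comp_symm_deriv
    (mem_chart_target (EuclideanSpace ℝ (Fin n)) x₀)
  exact det_gram_single_pos (mfderiv (𝓡 n) (𝓡 n) (chartAt (EuclideanSpace ℝ (Fin n)) x₀).symm
    (chartAt (EuclideanSpace ℝ (Fin n)) x₀ x₀)) <|
      Function.LeftInverse.injective (g := mfderiv (𝓡 n) (𝓡 n)
        (chartAt (EuclideanSpace ℝ (Fin n)) x₀) ((chartAt (EuclideanSpace ℝ (Fin n)) x₀).symm
          (chartAt (EuclideanSpace ℝ (Fin n)) x₀ x₀))) fun v ↦ congrArg (fun T ↦ T v) h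

variable [IsContMDiffRiemannianBundle (𝓡 n) ∞ (EuclideanSpace ℝ (Fin n))
    (fun x : M ↦ TangentSpace (𝓡 n) x)]

/-- The distortion relative to the centre is at most `r` for every `r > 1`; let `r` decrease to `1`.
-/
theorem continuousAt_norm_mfderiv_chartAt_symm (x₀ : M) (v : EuclideanSpace ℝ (Fin n)) :
    ContinuousAt (fun y ↦ ‖mfderiv (𝓡 n) (𝓡 n) (chartAt (EuclideanSpace ℝ (Fin n)) x₀).symm y v‖)
      (chartAt (EuclideanSpace ℝ (Fin n)) x₀ x₀) := by
  let e := chartAt (EuclideanSpace ℝ (Fin n)) x₀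
  have hy0 : e x₀ ∈ e.target := mem_chart_target _ x₀
  have key : ∀ r > 1, ∀ᶠ y in 𝓝 (e x₀),
      ‖mfderiv (𝓡 n) (𝓡 n) e.symm y v‖ ≤ r * chartNorm x₀ v ∧
      chartNorm x₀ v ≤ r * ‖mfderiv (𝓡 n) (𝓡 n) e.symm y v‖ := by
    intro r hr
    have h1 := eventually_norm_mfderiv_chartAt_symm (n := n) x₀ hr
    have hc : ContinuousAt e.symm (e x₀) := e.continuousAt_symm hy0
    have h2 : ∀ᶠ y in 𝓝 (e x₀), _ := hc.eventually
      (by rw [e.left_inv (mem_chart_source _ x₀)]; exact h1)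
    filter_upwards [e.open_target.eventually_mem hy0, h2] with y hy hy2
    have h3 := hy2 v
    have h4 : chartAt (EuclideanSpace ℝ (Fin n)) x₀ (e.symm y) = y := e.right_inv hy
    rw [h4] at h3
    exact h3
  change Tendsto _ _ (𝓝 (chartNorm x₀ v))
  rw [tendsto_order]
  have hN := chartNorm_nonneg (n := n) x₀ v
  constructor
  · intro a ha
    rcases lt_or_ge a 0 with ha0 | ha0
    · exact Eventually.of_forall fun y ↦ ha0.trans_le (norm_nonneg _)
    obtain ⟨r, hr1, hr⟩ : ∃ r > 1, r * a < chartNorm x₀ v := by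
      have : Tendsto (fun r ↦ r * a) (𝓝[>] 1) (𝓝 (1 * a)) :=
        ((continuous_mul_const a).tendsto 1).mono_left nhdsWithin_le_nhds
      obtain ⟨r, h1, h2⟩ := ((this.eventually_lt_const (by simpa using ha)).and
        self_mem_nhdsWithin).exists
      exact ⟨r, h2, h1⟩
    filter_upwards [key r hr1] with y hy
    exact lt_of_mul_lt_mul_left (hr.trans_le hy.2) (by linarith)
  · intro a ha
    obtain ⟨r, hr1, hr⟩ : ∃ r > 1, r * chartNorm x₀ v < a := by
      have : Tendsto (fun r ↦ r * chartNorm x₀ v) (𝓝[>] 1) (𝓝 (1 * chartNorm x₀ v)) :=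
        ((continuous_mul_const _).tendsto 1).mono_left nhdsWithin_le_nhds
      obtain ⟨r, h1, h2⟩ := ((this.eventually_lt_const (by simpa using ha)).and
        self_mem_nhdsWithin).exists
      exact ⟨r, h2, h1⟩
    filter_upwards [key r hr1] with y hy
    exact hy.1.trans_lt hr

/-- By polarization the entries are combinations of squared norms, whose continuity at the centre is
known. -/
theorem continuousAt_chartGram (x₀ : M) :
    ContinuousAt (chartGram x₀) (chartAt (EuclideanSpace ℝ (Fin n)) x₀ x₀) := by
  refine continuousAt_pi.2 fun a ↦ continuousAt_pi.2 fun b ↦ ?_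
  have h : (fun y ↦ chartGram x₀ y a b) = fun y ↦
      (‖mfderiv (𝓡 n) (𝓡 n) (chartAt (EuclideanSpace ℝ (Fin n)) x₀).symm y
        (EuclideanSpace.single a (1 : ℝ) + EuclideanSpace.single b (1 : ℝ))‖ ^ 2 -
      ‖mfderiv (𝓡 n) (𝓡 n) (chartAt (EuclideanSpace ℝ (Fin n)) x₀).symm y
        (EuclideanSpace.single a (1 : ℝ))‖ ^ 2 -
      ‖mfderiv (𝓡 n) (𝓡 n) (chartAt (EuclideanSpace ℝ (Fin n)) x₀).symm y
        (EuclideanSpace.single b (1 : ℝ))‖ ^ 2) / 2 := by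
    ext y
    rw [chartGram, Matrix.of_apply,
      real_inner_eq_norm_add_mul_self_sub_norm_mul_self_sub_norm_mul_self_div_two, sq, sq, sq]
    erw [map_add]
  rw [h]
  exact ((((continuousAt_norm_mfderiv_chartAt_symm x₀ _).pow 2).sub
    ((continuousAt_norm_mfderiv_chartAt_symm x₀ _).pow 2)).sub
    ((continuousAt_norm_mfderiv_chartAt_symm x₀ _).pow 2)).div_const 2

variable [IsRiemannianManifold (𝓡 n) M] [MeasurableSpace M] [BorelSpace M]

/-- Small balls have at least Euclidean volume, up to a constant. -/
theorem exists_mul_pow_le_riemannianVolume_ball (x₀ : M) : ∃ c > 0, ∃ r₀ > 0,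
    ∀ r, 0 < r → r ≤ r₀ →
      ENNReal.ofReal (c * r ^ n) ≤ riemannianVolume n M (Metric.ball x₀ r) := by
  let e := chartAt (EuclideanSpace ℝ (Fin n)) x₀
  obtain ⟨ρ, hρ, ht, hb⟩ := exists_ball_norm_mfderiv_chartAt_symm (n := n) x₀
  obtain ⟨A, hA, hAN⟩ := exists_chartNorm_le (n := n) x₀
  have hdet : ContinuousAt (fun y ↦ √(chartGram x₀ y).det) (e x₀) :=
    Real.continuous_sqrt.continuousAt.comp
      ((Continuous.matrix_det continuous_id).continuousAt.comp (continuousAt_chartGram x₀))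
  have hpos : 0 < √(chartGram x₀ (e x₀)).det := Real.sqrt_pos.2 (det_chartGram_pos x₀)
  set m := √(chartGram x₀ (e x₀)).det / 2
  have hm : 0 < m := half_pos hpos
  obtain ⟨σ, hσ, hσm⟩ := Metric.eventually_nhds_iff_ball.1
    (hdet.eventually_const_lt (half_lt_self hpos))
  obtain ⟨β, hβ, hv⟩ : ∃ β > 0,
      volume (Metric.ball (0 : EuclideanSpace ℝ (Fin n)) 1) = ENNReal.ofReal β :=
    ⟨_, ENNReal.toReal_pos (Metric.measure_ball_pos _ _ one_pos).ne' measure_ball_lt_top.ne,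
      (ENNReal.ofReal_toReal measure_ball_lt_top.ne).symm⟩
  -- The coordinate ball of radius `r / (2 * A)` maps into the metric ball of radius `r`, `m` bounds
  -- the volume density from below there, and `β` is the Euclidean volume of the unit ball.
  refine ⟨m * (1 / (2 * A)) ^ n * β,
    by positivity, 2 * A * min ρ σ, by positivity, fun r hr hr0 ↦ ?_⟩
  have hrA : r / (2 * A) ≤ min ρ σ := by rwa [div_le_iff₀' (by positivity)]
  have hsub : Metric.ball (e x₀) (r / (2 * A)) ⊆ e.target ∩ e.symm ⁻¹' Metric.ball x₀ r := by
    intro y hy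
    have hyρ : y ∈ Metric.ball (e x₀) ρ :=
      Metric.ball_subset_ball (hrA.trans (min_le_left _ _)) hy
    refine ⟨ht hyρ, ?_⟩
    have h1 := dist_chartAt_symm_le ht (fun y hy v ↦ (hb y hy v).1) hyρ
      (Metric.mem_ball_self hρ)
    rw [(chartAt (EuclideanSpace ℝ (Fin n)) x₀).left_inv (mem_chart_source _ x₀)] at h1
    have h2 := hAN (e x₀ - y)
    have h3 : ‖e x₀ - y‖ < r / (2 * A) := by
      rw [← dist_eq_norm, dist_comm]; exact hy
    rw [lt_div_iff₀ (by positivity)] at h3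
    refine Metric.mem_ball.2 (h1.trans_lt ?_)
    change 2 * chartNorm x₀ (e x₀ - y) < r
    linarith
  calc _ = ENNReal.ofReal m * volume (Metric.ball (e x₀) (r / (2 * A))) := by
        rw [Measure.addHaar_ball_of_pos _ _ (by positivity), finrank_euclideanSpace_fin, hv,
          ← ENNReal.ofReal_mul (by positivity), ← ENNReal.ofReal_mul hm.le]
        congr 1
        rw [div_pow, div_pow]
        ring
    _ = ∫⁻ y in Metric.ball (e x₀) (r / (2 * A)), ENNReal.ofReal m := by simp
    _ ≤ ∫⁻ y in Metric.ball (e x₀) (r / (2 * A)), ENNReal.ofReal (√(chartGram x₀ y).det) :=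
        setLIntegral_mono' measurableSet_ball fun y hy ↦ ENNReal.ofReal_le_ofReal
          (hσm y (Metric.ball_subset_ball (hrA.trans (min_le_right _ _)) hy)).le
    _ ≤ ∫⁻ y in e.target ∩ e.symm ⁻¹' Metric.ball x₀ r, ENNReal.ofReal (√(chartGram x₀ y).det) :=
        lintegral_mono_set hsub
    _ = chartVolume n x₀ (Metric.ball x₀ r) := (chartVolume_apply n x₀ measurableSet_ball).symm
    _ ≤ riemannianVolume n M (Metric.ball x₀ r) :=
        le_iSup (fun x : M ↦ chartVolume n x) x₀ _

end LocalVolume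

/-! ### Iteration of the Sobolev inequality over halved radii -/

section VolumeGrowth

open Filter Topology

/-- The sequence `α + k * β` of the proof solves the recursion with equality. The difference `d` of
`l` and this solution satisfies `θ * d (k + 1) ≤ d k`, hence `θ ^ k * d k ≤ d 0`. As `d` is
eventually bounded below by an affine function of `k`, the left side has nonnegative lower limit.
The bound does not involve `A` or `B`. -/
theorem le_of_affine_recursion {θ : ℝ} (h0 : 0 < θ) (h1 : θ < 1) {l : ℕ → ℝ} {a b A B : ℝ}
    (hrec : ∀ k, a + k * b + θ * l (k + 1) ≤ l k) (hlow : ∀ᶠ k : ℕ in atTop, A + k * B ≤ l k) :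
    (a + θ * (b / (1 - θ))) / (1 - θ) ≤ l 0 := by
  have hθ : 0 < 1 - θ := by linarith
  set β := b / (1 - θ)
  set α := (a + θ * β) / (1 - θ)
  have hβ : β * (1 - θ) = b := div_mul_cancel₀ _ hθ.ne'
  have hα : α * (1 - θ) = a + θ * β := div_mul_cancel₀ _ hθ.ne'
  have hw : ∀ k : ℕ, θ ^ k * (l k - (α + k * β)) ≤ l 0 - α := by
    intro k
    induction k with
    | zero => simp
    | succ k ih =>
      refine le_trans ?_ ih
      rw [pow_succ, mul_assoc]
      refine mul_le_mul_of_nonneg_left ?_ (by positivity)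
      have := hrec k
      push_cast
      linear_combination this + hα + k * hβ
  have hlim : Tendsto (fun k : ℕ ↦ (A - α) * θ ^ k + (B - β) * (k * θ ^ k)) atTop
      (𝓝 ((A - α) * 0 + (B - β) * 0)) :=
    ((tendsto_pow_atTop_nhds_zero_of_lt_one h0.le h1).const_mul _).add
      ((tendsto_self_mul_const_pow_of_lt_one h0.le h1).const_mul _)
  have hfin : (A - α) * 0 + (B - β) * 0 ≤ l 0 - α := by
    refine le_of_tendsto hlim ?_
    filter_upwards [hlow] with k hk
    refine le_trans ?_ (hw k)
    have : 0 ≤ θ ^ k * (l k - (A + k * B)) := mul_nonneg (by positivity) (by linarith)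
    linear_combination this
  linarith

variable {n : ℕ} {M : Type*} [MetricSpace M]
  [ChartedSpace (EuclideanSpace ℝ (Fin n)) M]
  [RiemannianBundle (fun x : M ↦ TangentSpace (𝓡 n) x)]

/-- Test the bound on the gradient `w` itself, for which the derivative is `‖w‖ ^ 2`. -/
theorem norm_riemannianGradient_le {φ : M → ℝ} {x : M} {c : ℝ} (hc : 0 ≤ c)
    (h : ∀ v : TangentSpace (𝓡 n) x, |directionalDeriv φ x v| ≤ c * ‖v‖) :
    ‖riemannianGradient n φ x‖ ≤ c := by
  set w := riemannianGradient n φ x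
  have h1 : inner ℝ w w = directionalDeriv φ x w :=
    haveI : FiniteDimensional ℝ (TangentSpace (𝓡 n) x) :=
      inferInstanceAs (FiniteDimensional ℝ (EuclideanSpace ℝ (Fin n)))
    haveI : CompleteSpace (TangentSpace (𝓡 n) x) := FiniteDimensional.complete ℝ _
    InnerProductSpace.toDual_symm_apply
  have h2 : ‖w‖ * ‖w‖ ≤ c * ‖w‖ := by
    rw [← real_inner_self_eq_norm_mul_norm, h1]
    exact (le_abs_self _).trans (h w)
  by_contra! hlt
  have : 0 < ‖w‖ := hc.trans_lt hlt
  nlinarith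

variable [IsManifold (𝓡 n) ∞ M] [IsContMDiffRiemannianBundle (𝓡 n) ∞ (EuclideanSpace ℝ (Fin n))
    (fun x : M ↦ TangentSpace (𝓡 n) x)]
  [IsRiemannianManifold (𝓡 n) M] [MeasurableSpace M] [BorelSpace M]
  [CompleteSpace M] [SecondCountableTopology M]

/-- The Sobolev inequality applied to a cutoff function compares volumes of concentric balls. -/
theorem SobolevInequalityOn.volume_ball_half_le {p q S C : ℝ} (hp : 0 < p) (hq : 0 < q)
    (hC : ∀ t, |deriv Real.smoothTransition t| ≤ C) {E : Set M}
    (hE : SobolevInequalityOn n q p S E) {x₀ : M} {r : ℝ} (hr : 0 < r)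
    (hball : Metric.ball x₀ r ⊆ E) :
    ENNReal.ofReal S * riemannianVolume n M (Metric.ball x₀ (r / 2)) ^ (1 / q) ≤
      ENNReal.ofReal (40 * C / r) * riemannianVolume n M (Metric.ball x₀ r) ^ (1 / p) := by
  have hC0 : 0 ≤ C := (abs_nonneg _).trans (hC 0)
  obtain ⟨φ, hφ, hsupp, hφ1, hφd⟩ := exists_contMDiff_cutoff (n := n) hC x₀ hr
  have hsub : Metric.closedBall x₀ (3 * r / 4) ⊆ Metric.ball x₀ r :=
    Metric.closedBall_subset_ball (by linarith)
  have hcomp : HasCompactSupport φ :=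
    (isCompact_closedBall_of_isRiemannianManifold (n := n) x₀ (3 * r / 4)).of_isClosed_subset
      (isClosed_tsupport φ) hsupp
  have h1 := hE φ hφ hcomp (hsupp.trans (hsub.trans hball))
  have hq' : ENNReal.ofReal q ≠ 0 := by simpa using hq
  have hp' : ENNReal.ofReal p ≠ 0 := by simpa using hp
  have hlow : riemannianVolume n M (Metric.ball x₀ (r / 2)) ^ (1 / q) ≤
      eLpNorm φ (ENNReal.ofReal q) (riemannianVolume n M) := by
    have h2 := eLpNorm_indicator_const (c := (1 : ℝ)) (μ := riemannianVolume n M)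
      (measurableSet_ball (x := x₀) (ε := r / 2)) hq' ENNReal.ofReal_ne_top
    rw [ENNReal.toReal_ofReal hq.le, enorm_one, one_mul] at h2
    rw [← h2]
    refine eLpNorm_mono fun x ↦ ?_
    by_cases hx : x ∈ Metric.ball x₀ (r / 2)
    · simp [hx, hφ1 x hx]
    · simp [hx]
  have hup : eLpNorm (fun x ↦ ‖riemannianGradient n φ x‖) (ENNReal.ofReal p)
      (riemannianVolume n M) ≤
      ENNReal.ofReal (40 * C / r) * riemannianVolume n M (Metric.ball x₀ r) ^ (1 / p) := by
    have h2 := eLpNorm_indicator_const (c := 40 * C / r) (μ := riemannianVolume n M)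
      (measurableSet_ball (x := x₀) (ε := r)) hp' ENNReal.ofReal_ne_top
    rw [ENNReal.toReal_ofReal hp.le, Real.enorm_eq_ofReal (by positivity)] at h2
    rw [← h2]
    refine eLpNorm_mono fun x ↦ ?_
    rw [norm_norm]
    by_cases hx : x ∈ Metric.ball x₀ r
    · rw [indicator_of_mem hx, Real.norm_of_nonneg (by positivity)]
      exact norm_riemannianGradient_le (by positivity) (hφd x)
    · rw [indicator_of_notMem hx, norm_zero]
      refine norm_riemannianGradient_le le_rfl fun v ↦ ?_
      have h0 : φ =ᶠ[𝓝 x] fun _ ↦ 0 :=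
        notMem_tsupport_iff_eventuallyEq.1 fun h ↦ hx (hsub (hsupp h))
      rw [directionalDeriv_congr h0, directionalDeriv_const, abs_zero, zero_mul]
  exact (mul_le_mul_right hlow _).trans (h1.trans hup)

/-- Balls inside a domain with an `L^{q,p}`-Sobolev inequality have polynomial volume growth. -/
theorem SobolevInequalityOn.ofReal_le_volume_ball {p q S C : ℝ} (hp : 0 < p) (hpq : p < q)
    (hS : 0 < S) (hC0 : 0 < C) (hC : ∀ t, |deriv Real.smoothTransition t| ≤ C) {E : Set M}
    (hE : SobolevInequalityOn n q p S E) {x₀ : M} {R : ℝ} (hR : 0 < R)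
    (hball : Metric.ball x₀ R ⊆ E) :
    ENNReal.ofReal (Real.exp ((p * Real.log (S / (40 * C)) +
        p / q * (-(p * Real.log 2) / (1 - p / q))) / (1 - p / q)) * R ^ (p / (1 - p / q))) ≤
      riemannianVolume n M (Metric.ball x₀ R) := by
  have hq : 0 < q := hp.trans hpq
  have hθ1 : p / q < 1 := (div_lt_one hq).2 hpq
  obtain ⟨c, hc, r₀, hr₀, hvol⟩ := exists_mul_pow_le_riemannianVolume_ball (n := n) x₀
  by_cases htop : riemannianVolume n M (Metric.ball x₀ R) = ⊤
  · rw [htop]; exact le_top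
  let r : ℕ → ℝ := fun k ↦ R / 2 ^ k
  let u : ℕ → ℝ := fun k ↦ (riemannianVolume n M (Metric.ball x₀ (r k))).toReal
  have hr : ∀ k, 0 < r k := fun k ↦ by positivity
  have hrR : ∀ k, r k ≤ R := fun k ↦ div_le_self hR.le (one_le_pow₀ one_le_two)
  have hfin : ∀ k, riemannianVolume n M (Metric.ball x₀ (r k)) ≠ ⊤ := fun k ↦
    ((measure_mono (Metric.ball_subset_ball (hrR k))).trans_lt (lt_top_iff_ne_top.2 htop)).ne
  have hu : ∀ k, riemannianVolume n M (Metric.ball x₀ (r k)) = ENNReal.ofReal (u k) := fun k ↦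
    (ENNReal.ofReal_toReal (hfin k)).symm
  have hupos : ∀ k, 0 < u k := fun k ↦ by
    have h1 := hvol (min (r k) r₀) (lt_min (hr k) hr₀) (min_le_right _ _)
    have h2 : 0 < c * min (r k) r₀ ^ n := by
      have := lt_min (hr k) hr₀
      positivity
    exact ENNReal.toReal_pos (((ENNReal.ofReal_pos.2 h2).trans_le h1).trans_le
      (measure_mono (Metric.ball_subset_ball (min_le_left _ _)))).ne' (hfin k)
  have hlogr : ∀ k, Real.log (r k) = Real.log R - k * Real.log 2 := fun k ↦ by
    rw [Real.log_div hR.ne' (by positivity), Real.log_pow]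
  -- This is `p` times the logarithm of the comparison at radius `R / 2 ^ k`. Positivity and
  -- finiteness of all the volumes are needed to take logarithms, which is why the infinite case was
  -- split off.
  have hrec : ∀ k : ℕ, p * (Real.log (S / (40 * C)) + Real.log R) + k * -(p * Real.log 2) +
      p / q * Real.log (u (k + 1)) ≤ Real.log (u k) := fun k ↦ by
    have h1 := hE.volume_ball_half_le hp hq hC (hr k)
      ((Metric.ball_subset_ball (hrR k)).trans hball)
    have h2 : r k / 2 = r (k + 1) := by simp only [r, pow_succ]; field_simp
    rw [h2, hu, hu, ENNReal.ofReal_rpow_of_pos (hupos _), ENNReal.ofReal_rpow_of_pos (hupos _),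
      ← ENNReal.ofReal_mul hS.le, ← ENNReal.ofReal_mul (by have := hr k; positivity),
      ENNReal.ofReal_le_ofReal_iff
        (by have := hr k; have := Real.rpow_nonneg (hupos k).le (1 / p); positivity)] at h1
    have hk := hr k
    have h3 := Real.log_le_log (mul_pos hS (Real.rpow_pos_of_pos (hupos _) _)) h1
    rw [Real.log_mul hS.ne' (Real.rpow_pos_of_pos (hupos _) _).ne',
      Real.log_mul (by positivity) (Real.rpow_pos_of_pos (hupos _) _).ne',
      Real.log_rpow (hupos _), Real.log_rpow (hupos _), Real.log_div (by positivity) hk.ne',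
      hlogr] at h3
    rw [Real.log_div hS.ne' (by positivity)]
    have h4 := mul_le_mul_of_nonneg_left h3 hp.le
    have h5 : p * (1 / p * Real.log (u k)) = Real.log (u k) := by field_simp
    have h6 : p * (1 / q * Real.log (u (k + 1))) = p / q * Real.log (u (k + 1)) := by ring
    linear_combination h4 + h5 - h6
  -- The local Euclidean bound makes the logarithms decrease at most linearly in `k`. It applies
  -- once `R / 2 ^ k` is below `r₀`, and its constants `c` and `n` drop out of the conclusion.
  have hlow : ∀ᶠ k : ℕ in atTop, (Real.log c + n * Real.log R) + k * -(n * Real.log 2) ≤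
      Real.log (u k) := by
    have ht : Tendsto r atTop (𝓝 0) := by
      have := (tendsto_pow_atTop_nhds_zero_of_lt_one (r := (1 / 2 : ℝ)) (by norm_num)
        (by norm_num)).const_mul R
      simpa [r, div_eq_mul_inv] using this
    filter_upwards [ht.eventually_lt_const hr₀] with k hk
    have h1 := hvol (r k) (hr k) hk.le
    rw [hu, ENNReal.ofReal_le_ofReal_iff (hupos k).le] at h1
    have h2 := Real.log_le_log (by have := hr k; positivity) h1
    rw [Real.log_mul hc.ne' (by have := hr k; positivity), Real.log_pow, hlogr] at h2
    linear_combination h2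
  have hmain := le_of_affine_recursion (div_pos hp hq) hθ1 hrec hlow
  have hu0 : riemannianVolume n M (Metric.ball x₀ R) = ENNReal.ofReal (u 0) := by
    rw [← hu 0]; simp [r]
  rw [hu0]
  refine ENNReal.ofReal_le_ofReal ?_
  rw [Real.rpow_def_of_pos hR, ← Real.exp_add, ← Real.le_log_iff_exp_le (hupos 0)]
  refine le_trans (le_of_eq ?_) hmain
  ring

end VolumeGrowth

/-! ### Balls inside an end -/

section Ends

/-- A ball around a point of `E` which does not meet `K` stays in `E`. -/
theorem IsEndOf.ball_subset {n : ℕ} {M : Type*} [MetricSpace M]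
    [ChartedSpace (EuclideanSpace ℝ (Fin n)) M] [IsManifold (𝓡 n) ∞ M]
    [RiemannianBundle (fun x : M ↦ TangentSpace (𝓡 n) x)] [IsRiemannianManifold (𝓡 n) M]
    {K E : Set M} (hE : IsEndOf K E) {o x₀ : M} {R₀ R : ℝ} (hK : K ⊆ Metric.ball o R₀)
    (hx₀ : x₀ ∈ E) (hR : R + R₀ ≤ dist x₀ o) : Metric.ball x₀ R ⊆ E := by
  rcases le_or_gt R 0 with hR0 | hR0
  · simp [Metric.ball_eq_empty.2 hR0]
  obtain ⟨⟨z, -, rfl⟩, -⟩ := hE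
  rw [connectedComponentIn_eq hx₀]
  refine (isPreconnected_ball_of_isRiemannianManifold (n := n) x₀ R).subset_connectedComponentIn
    (Metric.mem_ball_self hR0) fun y hy hyK ↦ ?_
  have h1 := Metric.mem_ball.1 (hK hyK)
  have h2 := Metric.mem_ball'.1 hy
  have := dist_triangle x₀ y o
  linarith

end Ends

/-! ### The three claims assembled -/

theorem mainTheorem7 (p q S : ℝ) (hp : 1 ≤ p) (hpq : p < q) (hS : 0 < S) :
    ∃ C₁ C₂ : ℝ, 0 < C₁ ∧ 0 < C₂ ∧
      ∀ (n : ℕ) (M : Type*) [MetricSpace M] [CompleteSpace M] [SecondCountableTopology M]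
        [MeasurableSpace M] [BorelSpace M]
        [ChartedSpace (EuclideanSpace ℝ (Fin n)) M] [IsManifold (𝓡 n) ∞ M]
        [RiemannianBundle (fun x : M ↦ TangentSpace (𝓡 n) x)]
        [IsContMDiffRiemannianBundle (𝓡 n) ∞ (EuclideanSpace ℝ (Fin n))
          (fun x : M ↦ TangentSpace (𝓡 n) x)]
        [IsRiemannianManifold (𝓡 n) M]
        (K E : Set M), IsCompact K → IsEndOf K E → SobolevInequalityOn n q p S E →
          (∀ (x₀ : M) (R : ℝ), 0 < R → Metric.ball x₀ R ⊆ E →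
            ENNReal.ofReal (C₁ * R ^ C₂) ≤ riemannianVolume n M (Metric.ball x₀ R)) ∧
          (∀ (o : M) (R₀ : ℝ), K ⊆ Metric.ball o R₀ → ∀ (R : ℝ) (x₀ : M), x₀ ∈ E →
            R + R₀ ≤ dist x₀ o → Metric.ball x₀ R ⊆ E) ∧
          riemannianVolume n M E = ⊤
 := by
  have hp0 : 0 < p := zero_lt_one.trans_le hp
  have hθ : 0 < 1 - p / q := sub_pos.2 ((div_lt_one (hp0.trans hpq)).2 hpq)
  obtain ⟨C, hC0, hC⟩ := exists_abs_deriv_smoothTransition_le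
  refine ⟨Real.exp ((p * Real.log (S / (40 * C)) +
    p / q * (-(p * Real.log 2) / (1 - p / q))) / (1 - p / q)), p / (1 - p / q),
    Real.exp_pos _, by positivity, ?_⟩
  set C₁ := Real.exp ((p * Real.log (S / (40 * C)) +
    p / q * (-(p * Real.log 2) / (1 - p / q))) / (1 - p / q))
  intro n M _ _ _ _ _ _ _ _ _ _ K E hK hE hSob
  have hball : ∀ (x₀ : M) (R : ℝ), 0 < R → Metric.ball x₀ R ⊆ E →
      ENNReal.ofReal (C₁ * R ^ (p / (1 - p / q))) ≤ riemannianVolume n M (Metric.ball x₀ R) :=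
    fun x₀ R hR hsub ↦ hSob.ofReal_le_volume_ball hp0 hpq hS hC0 hC hR hsub
  have hsub : ∀ (o : M) (R₀ : ℝ), K ⊆ Metric.ball o R₀ → ∀ (R : ℝ) (x₀ : M), x₀ ∈ E →
      R + R₀ ≤ dist x₀ o → Metric.ball x₀ R ⊆ E :=
    fun o R₀ hKo R x₀ hx₀ hR ↦ hE.ball_subset (n := n) hKo hx₀ hR
  refine ⟨hball, hsub, ?_⟩
  obtain ⟨⟨o, -, -⟩, hunb⟩ := id hE
  obtain ⟨R₀, hKo⟩ := hK.isBounded.subset_ball o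
  have hlarge : ∀ R : ℝ, 0 < R →
      ENNReal.ofReal (C₁ * R ^ (p / (1 - p / q))) ≤ riemannianVolume n M E := by
    intro R hR
    -- Otherwise `E` would lie in the ball of radius `R + R₀` about `o`, against unboundedness.
    obtain ⟨x₀, hx₀, hx₀R⟩ : ∃ x₀ ∈ E, R + R₀ ≤ dist x₀ o := by
      by_contra! h
      exact hunb (Metric.isBounded_ball.subset fun x hx ↦ Metric.mem_ball.2 (h x hx))
    have h1 := hsub o R₀ hKo R x₀ hx₀ hx₀R
    exact (hball x₀ R hR h1).trans (measure_mono h1)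
  have hlim : Filter.Tendsto (fun R : ℝ ↦ ENNReal.ofReal (C₁ * R ^ (p / (1 - p / q))))
      Filter.atTop (nhds ⊤) :=
    ENNReal.tendsto_ofReal_atTop.comp
      ((tendsto_rpow_atTop (div_pos hp0 hθ)).const_mul_atTop (Real.exp_pos _))
  exact top_le_iff.1 (le_of_tendsto hlim
    ((Filter.eventually_gt_atTop 0).mono hlarge))
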